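/- Let $\Gamma=(V,E,s,r)$ be a finite directed graph, $F$ a field, and $L(\Gamma)$ the Leavitt path algebra of $\Gamma$ over $F$, $\mathbb Z$-graded by $\deg v=0$, $\deg e=1$, $\deg e^*=-1$. Paths are sequences $p=e_1\cdots e_n$ of composable edges, of length $l(p)=n$; vertices are the paths of length $0$. A nonempty set $W\subseteq V$ is hereditary if it contains the range of every path with source in $W$; let $W_1,\dots,W_k$ (the frame of $\Gamma$) be all the minimal hereditary subsets of $V$. A specialization is a map $\gamma$ from the set of vertices that are not sinks to $E$ with $s(\gamma(v))=v$; the edges in its image are called special, and a path of length at least $1$ is special if all its edges are. For a path $p$ let $sd(p)$ be the length of the longest final segment of $p$ that consists of special edges. For real $n,s,d\ge 0$ let $V_{n,s,d}\subseteq L(\Gamma)$ be the $F$-span of all $pq^*$, with paths $p,q$ such that $l(p)+l(q)\ge n$, $sd(p)+sd(q)\le s$ and $|l(p)-l(q)|\le d$, and for $k\ge 1$ let $V_k=\sum\{V_{n,s,d}\mid n\ge k(s+d+1)\}$. The subspaces $V_k$ form a basis of neighborhoods of $0$ for an algebra topology on $L(\Gamma)$. Let $\overline{L(\Gamma)}$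 be the completion, $\overline{L(\Gamma)_i}$ the closure in it of the homogeneous component $L(\Gamma)_i$, and $\widehat L(\Gamma)=\sum_{i\in\mathbb Z}\overline{L(\Gamma)_i}$, with the topology induced from $\overline{L(\Gamma)}$. For a hereditary set $W$ let $I(W)$ be the closed two-sided ideal of $\widehat L(\Gamma)$ generated by $W$. The specialization $\gamma$ is called regular if (1) there are only finitely many special paths all vertices of which lie in $V\setminus\bigcup_i W_i$, and (2) for each $i$, the undirected graph with vertex set $W_i$, whose edges are the special edges with source in $W_i$ without their directions, is connected. **Proposition.** If $\gamma$ is a regular specialization, then each ideal $I(W_i)$ is a topologically graded simple algebra: it is graded by its subspaces $I(W_i)\cap\overline{L(\Gamma)_j}$, $j\in\mathbb Z$, its multiplication is not identically zero, and its only closed graded two-sided ideals are $0$ and $I(W_i)$. -/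

import Mathlib

/-- A directed graph with vertices `V` and edges `E` (loops and multiple edges are allowed),
given by the source map `s` and the range map `r`. -/
structure DirGraph (V E : Type*) where
  s : E → V
  r : E → V

namespace DirGraph

variable {V E : Type*} (G : DirGraph V E)

/-- A sink is a vertex which is the source of no edge. -/
def IsSink (v : V) : Prop := ∀ e : E, G.s e ≠ v

/-- `G.IsWalk v l w`: the edges of the list `l` can be composed, in this order, to a path
that starts at `v` and ends at `w`. For `l = []` this means `v = w`. -/
def IsWalk : V → List E → V → Prop
  | v, [], w => v = w
  | v, e :: l, w => G.s e = v ∧ IsWalk (G.r e) l w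

/-- A path `e₁ ⋯ eₙ`, `n ≥ 0`; the paths of length `0` are the vertices. -/
structure Path where
  src : V
  edges : List E
  tgt : V
  isWalk : G.IsWalk src edges tgt

/-- The length `l(p)`. -/
def Path.length {G : DirGraph V E} (p : G.Path) : ℕ := p.edges.length

/-- `w` is a descendant of `v`: there is a path from `v` to `w`. -/
def IsDescendant (v w : V) : Prop := ∃ p : G.Path, p.src = v ∧ p.tgt = w

/-- Nonempty sets of vertices which contain all descendants of their elements. -/
def IsHereditary (W : Set V) : Prop :=
  W.Nonempty ∧ ∀ w ∈ W, ∀ u, G.IsDescendant w u → u ∈ W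

/-- The frame of the graph: the set of all minimal hereditary sets of vertices. -/
def frame : Set (Set V) := {W | Minimal G.IsHereditary W}

/-- A specialization: the choice of an edge `γ(v)` with source `v` for every non-sink `v`. -/
structure Specialization where
  toFun : {v : V // ¬ G.IsSink v} → E
  s_toFun : ∀ v, G.s (toFun v) = v

namespace Specialization

variable {G} (γ : G.Specialization)

/-- Special edges are those in the image of `γ`. -/
def IsSpecial (e : E) : Prop := e ∈ Set.range γ.toFun

/-- A special path is a path of length at least `1`, all edges of which are special. -/
def IsSpecialPath (p : G.Path) : Prop := p.edges ≠ [] ∧ ∀ e ∈ p.edges, γ.IsSpecial e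

open Classical in
/-- The length of the longest final segment of the list that consists of special edges. -/
noncomputable def sdList (l : List E) : ℕ :=
  (l.rtakeWhile (fun e => decide (γ.IsSpecial e))).length

/-- `sd(p) = n - i`, where `p = e₁ ⋯ eₙ` and `i` is minimal such that all edges of
`eᵢ₊₁ ⋯ eₙ` are special (`i = n` if `eₙ` is not special). -/
noncomputable def sd (p : G.Path) : ℕ := γ.sdList p.edges

/-- The undirected graph on a set `W` of vertices, whose edges are the special edges between
vertices of `W` without their directions (loops, which are irrelevant for connectedness, and
multiplicities are dropped). If `W` is hereditary, then every special edge with source in `W`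
has its range in `W`, so that this is the graph of the restriction of `γ` to `W`. -/
def undirected (W : Set V) : SimpleGraph W :=
  SimpleGraph.fromRel fun a b => ∃ e : E, γ.IsSpecial e ∧ G.s e = a ∧ G.r e = b

/-- A specialization is regular if there are finitely many special paths all vertices of which
lie outside of the union of the frame, and if it induces a connected undirected graph on each
of the sets of the frame. -/
structure IsRegular : Prop where
  finite : {p : G.Path | γ.IsSpecialPath p ∧
    ∀ e ∈ p.edges, G.s e ∉ ⋃₀ G.frame ∧ G.r e ∉ ⋃₀ G.frame}.Finite
  connected : ∀ W ∈ G.frame, (γ.undirected W).Connected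

end Specialization

/-- The generators `v`, `e`, `e*` of the Leavitt path algebra. -/
inductive Gen (V E : Type*)
  | vtx (v : V)
  | edge (e : E)
  | ghost (e : E)

open FreeAlgebra in
open Classical in
/-- The defining relations of the Leavitt path algebra of a finite graph. The last one says that
the sum of all vertices, which by the other relations is a neutral element of the non-unital
algebra presented by them, is the `1` of the unital free algebra used here. -/
inductive LeavittRel (F : Type*) [Field F] [Fintype V] [Fintype E] :
    FreeAlgebra F (Gen V E) → FreeAlgebra F (Gen V E) → Prop
  | vtx_mul_self (v : V) : LeavittRel F (ι F (.vtx v) * ι F (.vtx v)) (ι F (.vtx v))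
  | vtx_mul_vtx (v w : V) (h : v ≠ w) : LeavittRel F (ι F (.vtx v) * ι F (.vtx w)) 0
  | vtx_mul_edge (e : E) : LeavittRel F (ι F (.vtx (G.s e)) * ι F (.edge e)) (ι F (.edge e))
  | edge_mul_vtx (e : E) : LeavittRel F (ι F (.edge e) * ι F (.vtx (G.r e))) (ι F (.edge e))
  | vtx_mul_ghost (e : E) : LeavittRel F (ι F (.vtx (G.r e)) * ι F (.ghost e)) (ι F (.ghost e))
  | ghost_mul_vtx (e : E) : LeavittRel F (ι F (.ghost e) * ι F (.vtx (G.s e))) (ι F (.ghost e))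
  | ghost_mul_edge_self (e : E) :
      LeavittRel F (ι F (.ghost e) * ι F (.edge e)) (ι F (.vtx (G.r e)))
  | ghost_mul_edge (e f : E) (h : e ≠ f) : LeavittRel F (ι F (.ghost e) * ι F (.edge f)) 0
  | vtx_eq_sum (v : V) (h : ¬ G.IsSink v) :
      LeavittRel F (ι F (.vtx v))
        (∑ e : E with G.s e = v, ι F (.edge e) * ι F (.ghost e))
  | one : LeavittRel F 1 (∑ v : V, ι F (.vtx v))

/-- The Leavitt path algebra `L(Γ)` over `F`. -/
def Leavitt (F : Type*) [Field F] [Fintype V] [Fintype E] : Type _ := RingQuot (G.LeavittRel F)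

namespace Leavitt

variable (F : Type*) [Field F] [Fintype V] [Fintype E]

noncomputable instance : Ring (G.Leavitt F) := inferInstanceAs (Ring (RingQuot (G.LeavittRel F)))

noncomputable instance : Algebra F (G.Leavitt F) :=
  inferInstanceAs (Algebra F (RingQuot (G.LeavittRel F)))

/-- The quotient map from the free algebra. -/
noncomputable def mk : FreeAlgebra F (Gen V E) →ₐ[F] G.Leavitt F :=
  RingQuot.mkAlgHom F (G.LeavittRel F)

variable {G}

noncomputable def vtx (v : V) : G.Leavitt F := mk G F (FreeAlgebra.ι F (.vtx v))

noncomputable def edge (e : E) : G.Leavitt F := mk G F (FreeAlgebra.ι F (.edge e))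

noncomputable def ghost (e : E) : G.Leavitt F := mk G F (FreeAlgebra.ι F (.ghost e))

/-- The element `e₁ ⋯ eₙ` for a list of edges with source `v`, and `v` for the empty list. -/
noncomputable def real (v : V) (l : List E) : G.Leavitt F := vtx F v * (l.map (edge F)).prod

/-- The element `eₙ* ⋯ e₁*` for a list of edges with source `v`, and `v` for the empty list. -/
noncomputable def star (v : V) (l : List E) : G.Leavitt F :=
  (l.reverse.map (ghost F)).prod * vtx F v

/-- The element `p q*` of the Leavitt path algebra. -/
noncomputable def monomial (p q : G.Path) : G.Leavitt F := real F p.src p.edges * star F q.src q.edges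

variable (G) in
/-- The homogeneous component of degree `i` for the grading in which vertices, edges and ghost
edges have degrees `0`, `1` and `-1`. -/
noncomputable def component (i : ℤ) : Submodule F (G.Leavitt F) :=
  Submodule.span F {x | ∃ p q : G.Path, p.tgt = q.tgt ∧ (p.length : ℤ) - q.length = i ∧
    x = monomial F p q}

theorem rel {a b : FreeAlgebra F (Gen V E)} (h : G.LeavittRel F a b) : mk G F a = mk G F b :=
  RingQuot.mkAlgHom_rel F h

theorem vtx_mul_self (v : V) : (vtx F v * vtx F v : G.Leavitt F) = vtx F v := by
  simpa [vtx] using rel F (LeavittRel.vtx_mul_self (G := G) v)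

theorem vtx_mul_vtx {v w : V} (h : v ≠ w) : (vtx F v * vtx F w : G.Leavitt F) = 0 := by
  simpa [vtx] using rel F (LeavittRel.vtx_mul_vtx (G := G) v w h)

theorem vtx_mul_edge (e : E) : (vtx F (G.s e) * edge F e : G.Leavitt F) = edge F e := by
  simpa [vtx, edge] using rel F (LeavittRel.vtx_mul_edge (G := G) e)

theorem edge_mul_vtx (e : E) : (edge F e * vtx F (G.r e) : G.Leavitt F) = edge F e := by
  simpa [vtx, edge] using rel F (LeavittRel.edge_mul_vtx (G := G) e)

theorem vtx_mul_ghost (e : E) : (vtx F (G.r e) * ghost F e : G.Leavitt F) = ghost F e := by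
  simpa [vtx, ghost] using rel F (LeavittRel.vtx_mul_ghost (G := G) e)

theorem ghost_mul_vtx (e : E) : (ghost F e * vtx F (G.s e) : G.Leavitt F) = ghost F e := by
  simpa [vtx, ghost] using rel F (LeavittRel.ghost_mul_vtx (G := G) e)

theorem ghost_mul_edge_self (e : E) : (ghost F e * edge F e : G.Leavitt F) = vtx F (G.r e) := by
  simpa [vtx, edge, ghost] using rel F (LeavittRel.ghost_mul_edge_self (G := G) e)

theorem ghost_mul_edge {e f : E} (h : e ≠ f) : (ghost F e * edge F f : G.Leavitt F) = 0 := by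
  simpa [edge, ghost] using rel F (LeavittRel.ghost_mul_edge (G := G) e f h)

theorem one_eq : (1 : G.Leavitt F) = ∑ v : V, vtx F v := by
  simpa [vtx] using rel F (LeavittRel.one (G := G))

theorem vtx_mul_real (v : V) (l : List E) :
    (vtx F v * real F v l : G.Leavitt F) = real F v l := by
  rw [real, ← mul_assoc, vtx_mul_self]

theorem star_mul_vtx (v : V) (l : List E) :
    (star F v l * vtx F v : G.Leavitt F) = star F v l := by
  rw [star, mul_assoc, vtx_mul_self]

theorem real_cons (e : E) (l : List E) :
    (real F (G.s e) (e :: l) : G.Leavitt F) = edge F e * real F (G.r e) l := by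
  simp only [real, List.map_cons, List.prod_cons]
  rw [← mul_assoc, vtx_mul_edge, ← mul_assoc, edge_mul_vtx]

theorem star_cons (e : E) (l : List E) :
    (star F (G.s e) (e :: l) : G.Leavitt F) = star F (G.r e) l * ghost F e := by
  simp only [star, List.reverse_cons, List.map_append, List.map_cons, List.map_nil,
    List.prod_append, List.prod_cons, List.prod_nil, mul_one]
  rw [mul_assoc, ghost_mul_vtx, mul_assoc, vtx_mul_ghost]

theorem real_mul_vtx {v w : V} {l : List E} (h : G.IsWalk v l w) :
    (real F v l * vtx F w : G.Leavitt F) = real F v l := by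
  induction l generalizing v with
  | nil => obtain rfl : v = w := h
           simp [real, vtx_mul_self]
  | cons e l ih =>
    obtain ⟨rfl, h⟩ := h
    rw [real_cons, mul_assoc, ih h]

theorem vtx_mul_star {v w : V} {l : List E} (h : G.IsWalk v l w) :
    (vtx F w * star F v l : G.Leavitt F) = star F v l := by
  induction l generalizing v with
  | nil => obtain rfl : v = w := h
           simp [star, vtx_mul_self]
  | cons e l ih =>
    obtain ⟨rfl, h⟩ := h
    rw [star_cons, ← mul_assoc, ih h]

end Leavitt

theorem IsWalk.append {G : DirGraph V E} {u v w : V} {l m : List E} (h : G.IsWalk u l v)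
    (h' : G.IsWalk v m w) : G.IsWalk u (l ++ m) w := by
  induction l generalizing u with
  | nil => obtain rfl : u = v := h
           exact h'
  | cons e l ih => exact ⟨h.1, ih h.2⟩

namespace Leavitt

variable {G} (F : Type*) [Field F] [Fintype V] [Fintype E]

theorem real_append {u v : V} {l : List E} (h : G.IsWalk u l v) (m : List E) :
    (real F u l * real F v m : G.Leavitt F) = real F u (l ++ m) := by
  rw [real.eq_def F v m, ← mul_assoc, real_mul_vtx F h]
  simp [real, mul_assoc]

theorem star_append {u v : V} {l : List E} (h : G.IsWalk u l v) (m : List E) :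
    (star F v m * star F u l : G.Leavitt F) = star F u (l ++ m) := by
  rw [star.eq_def F v m, mul_assoc, vtx_mul_star F h]
  simp [star, mul_assoc]

/-- The product `q* p` vanishes unless one of the two paths is a continuation of the other. -/
theorem star_mul_real {u v u' v' : V} {l m : List E} (h : G.IsWalk u l v)
    (h' : G.IsWalk u' m v') :
    (star F u l * real F u' m : G.Leavitt F) = 0 ∨
    (∃ m', m = l ++ m' ∧ G.IsWalk v m' v' ∧
      (star F u l * real F u' m : G.Leavitt F) = real F v m') ∨
    (∃ l', l = m ++ l' ∧ G.IsWalk v' l' v ∧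
      (star F u l * real F u' m : G.Leavitt F) = star F v' l') := by
  induction l generalizing u u' m with
  | nil =>
    obtain rfl : u = v := h
    by_cases huu : u = u'
    · subst huu
      exact Or.inr (Or.inl ⟨m, rfl, h', by simp [star, vtx_mul_real]⟩)
    · left
      simp [star, real, ← mul_assoc, vtx_mul_vtx F huu]
  | cons e l ih =>
    by_cases huu : u = u'
    · subst huu
      cases m with
      | nil =>
        obtain rfl : u = v' := h'
        exact Or.inr (Or.inr ⟨e :: l, rfl, h, by simp [real, star_mul_vtx]⟩)
      | cons f m =>
        obtain ⟨hu, h⟩ := h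
        obtain ⟨hu', h'⟩ := h'
        have key : (star F u (e :: l) * real F u (f :: m) : G.Leavitt F) =
            star F (G.r e) l * (ghost F e * edge F f) * real F (G.r f) m := by
          rw [show (star F u (e :: l) : G.Leavitt F) = star F (G.r e) l * ghost F e by
              rw [← hu]; exact star_cons F e l,
            show (real F u (f :: m) : G.Leavitt F) = edge F f * real F (G.r f) m by
              rw [← hu']; exact real_cons F f m]
          simp only [mul_assoc]
        by_cases hef : e = f
        · subst hef
          rw [ghost_mul_edge_self, star_mul_vtx] at key
          rw [key]
          rcases ih h h' with h0 | ⟨m', rfl, hw, hm⟩ | ⟨l', rfl, hw, hl⟩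
          · exact Or.inl h0
          · exact Or.inr (Or.inl ⟨m', rfl, hw, hm⟩)
          · exact Or.inr (Or.inr ⟨l', rfl, hw, hl⟩)
        · left
          rw [key, ghost_mul_edge F hef]
          simp
    · left
      simp only [star, real]
      rw [mul_assoc, ← mul_assoc (vtx F u), vtx_mul_vtx F huu]
      simp

/-- The product of two monomials is zero or a monomial. -/
theorem monomial_mul (p q p' q' : G.Path) (hpq' : p'.tgt = q'.tgt) (hpq : p.tgt = q.tgt) :
    (monomial F p q * monomial F p' q' : G.Leavitt F) = 0 ∨
    (∃ a : G.Path, ∃ m, a.tgt = q'.tgt ∧ a.edges = p.edges ++ m ∧ p'.edges = q.edges ++ m ∧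
      monomial F p q * monomial F p' q' = monomial F a q') ∨
    (∃ b : G.Path, ∃ m, p.tgt = b.tgt ∧ b.edges = q'.edges ++ m ∧ q.edges = p'.edges ++ m ∧
      monomial F p q * monomial F p' q' = monomial F p b) := by
  have e : (monomial F p q * monomial F p' q' : G.Leavitt F) =
      real F p.src p.edges * (star F q.src q.edges * real F p'.src p'.edges) *
        star F q'.src q'.edges := by
    simp only [monomial, mul_assoc]
  rcases star_mul_real F q.isWalk p'.isWalk with h | ⟨m, hm, hw, h⟩ | ⟨m, hm, hw, h⟩
  · left
    rw [e, h]
    simp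
  · right; left
    have hp := p.isWalk
    rw [hpq] at hp
    refine ⟨⟨p.src, p.edges ++ m, p'.tgt, hp.append hw⟩, m, hpq', rfl, hm, ?_⟩
    rw [e, h, real_append F hp]
    rfl
  · right; right
    have hq := q'.isWalk
    rw [← hpq'] at hq
    refine ⟨⟨q'.src, q'.edges ++ m, q.tgt, hq.append hw⟩, m, hpq, rfl, hm, ?_⟩
    rw [e, h, mul_assoc, star_append F hq]
    rfl

theorem component_mul {i j : ℤ} {x y : G.Leavitt F} (hx : x ∈ component G F i)
    (hy : y ∈ component G F j) : x * y ∈ component G F (i + j) := by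
  have h := Submodule.mul_mem_mul hx hy
  rw [component, component, Submodule.span_mul_span] at h
  refine Submodule.span_le.2 ?_ h
  rintro _ ⟨_, ⟨p, q, hpq, hi, rfl⟩, _, ⟨p', q', hpq', hj, rfl⟩, rfl⟩
  simp only [Path.length] at hi hj
  rcases monomial_mul F p q p' q' hpq' hpq with h | ⟨a, m, ht, ha, hm, h⟩ | ⟨b, m, ht, hb, hm, h⟩
  · simp only [h]
    exact Submodule.zero_mem _
  · refine Submodule.subset_span ⟨a, q', ht, ?_, h⟩
    simp only [Path.length, ha]
    rw [hm] at hj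
    simp only [List.length_append] at hj ⊢
    push_cast at hj ⊢
    lia
  · refine Submodule.subset_span ⟨p, b, ht, ?_, h⟩
    simp only [Path.length, hb]
    rw [hm] at hi
    simp only [List.length_append] at hi ⊢
    push_cast at hi ⊢
    lia

/-- The path of length `0` at `v`. -/
def nilPath (v : V) : G.Path := ⟨v, [], v, rfl⟩

theorem vtx_eq_monomial (v : V) :
    (vtx F v : G.Leavitt F) = monomial F (nilPath v) (nilPath v) := by
  simp [monomial, nilPath, real, star, vtx_mul_self]

theorem edge_eq_monomial (e : E) : (edge F e : G.Leavitt F) =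
    monomial F ⟨G.s e, [e], G.r e, rfl, rfl⟩ (nilPath (G.r e)) := by
  simp [monomial, nilPath, real, star, vtx_mul_edge, edge_mul_vtx]

theorem ghost_eq_monomial (e : E) : (ghost F e : G.Leavitt F) =
    monomial F (nilPath (G.r e)) ⟨G.s e, [e], G.r e, rfl, rfl⟩ := by
  simp [monomial, nilPath, real, star, ghost_mul_vtx, vtx_mul_ghost]

theorem vtx_mem_component (v : V) : (vtx F v : G.Leavitt F) ∈ component G F 0 :=
  Submodule.subset_span ⟨nilPath v, nilPath v, rfl, by simp, vtx_eq_monomial F v⟩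

theorem one_mem_component : (1 : G.Leavitt F) ∈ component G F 0 := by
  rw [one_eq]
  exact Submodule.sum_mem _ fun v _ => vtx_mem_component F v

theorem induction_alg (S : Subalgebra F (G.Leavitt F))
    (h : ∀ p q : G.Path, p.tgt = q.tgt → monomial F p q ∈ S) (x : G.Leavitt F) : x ∈ S := by
  obtain ⟨y, rfl⟩ := RingQuot.mkAlgHom_surjective F (G.LeavittRel F) x
  change mk G F y ∈ S
  induction y using FreeAlgebra.induction with
  | grade0 r => rw [AlgHom.commutes]; exact S.algebraMap_mem r
  | grade1 g =>
    cases g with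
    | vtx v =>
      change vtx F v ∈ S
      rw [vtx_eq_monomial]
      exact h _ _ rfl
    | edge e =>
      change edge F e ∈ S
      rw [edge_eq_monomial]
      exact h _ _ rfl
    | ghost e =>
      change ghost F e ∈ S
      rw [ghost_eq_monomial]
      exact h _ _ rfl
  | mul a b ha hb => rw [map_mul]; exact S.mul_mem ha hb
  | add a b ha hb => rw [map_add]; exact S.add_mem ha hb

end Leavitt

namespace Specialization

open Leavitt

variable {G} (γ : G.Specialization)

theorem sdList_append_le (l m : List E) : γ.sdList (l ++ m) ≤ γ.sdList l + γ.sdList m := by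
  classical
  simp only [sdList, List.rtakeWhile, List.reverse_append, List.takeWhile_append,
    List.length_reverse]
  split_ifs with h
  · simp only [List.length_append, List.length_reverse] at h ⊢
    lia
  · lia

theorem sdList_le_append (l m : List E) : γ.sdList m ≤ γ.sdList (l ++ m) := by
  classical
  simp only [sdList, List.rtakeWhile, List.reverse_append, List.takeWhile_append,
    List.length_reverse]
  split_ifs with h
  · simp only [List.length_append, List.length_reverse] at h ⊢
    lia
  · lia

variable (F : Type*) [Field F] [Fintype V] [Fintype E]

/-- The subspace `V_{n,s,d}` of `L(Γ)`. -/
noncomputable def nsdSubspace (n s d : ℝ) : Submodule F (G.Leavitt F) :=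
  Submodule.span F {x | ∃ p q : G.Path, p.tgt = q.tgt ∧ n ≤ (p.length : ℝ) + q.length ∧
    (γ.sd p : ℝ) + γ.sd q ≤ s ∧ |(p.length : ℝ) - q.length| ≤ d ∧ x = monomial F p q}

/-- The subspace `V_k`, the sum of all `V_{n,s,d}` with `n ≥ k (s + d + 1)`. -/
noncomputable def nbhd (k : ℝ) : Submodule F (G.Leavitt F) :=
  ⨆ (n : ℝ) (s : ℝ) (d : ℝ) (_ : 0 ≤ n ∧ 0 ≤ s ∧ 0 ≤ d ∧ k * (s + d + 1) ≤ n),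
    γ.nsdSubspace F n s d

/-- The spanning set of `V_k`. -/
def nbhdGen (k : ℝ) : Set (G.Leavitt F) :=
  {x | ∃ p q : G.Path, p.tgt = q.tgt ∧
    k * ((γ.sd p : ℝ) + γ.sd q + |(p.length : ℝ) - q.length| + 1) ≤ (p.length : ℝ) + q.length ∧
    x = monomial F p q}

theorem nbhd_eq_span {k : ℝ} (hk : 0 ≤ k) : γ.nbhd F k = Submodule.span F (γ.nbhdGen F k) := by
  apply le_antisymm
  · refine iSup_le fun n => iSup_le fun s => iSup_le fun d => iSup_le fun h => ?_
    refine Submodule.span_mono ?_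
    rintro x ⟨p, q, hpq, hn, hs, hd, rfl⟩
    refine ⟨p, q, hpq, ?_, rfl⟩
    have := mul_le_mul_of_nonneg_left
      (show (γ.sd p : ℝ) + γ.sd q + |(p.length : ℝ) - q.length| + 1 ≤ s + d + 1 by linarith) hk
    linarith [h.2.2.2]
  · rw [Submodule.span_le]
    rintro x ⟨p, q, hpq, h, rfl⟩
    refine Submodule.mem_iSup_of_mem ((p.length : ℝ) + q.length)
      (Submodule.mem_iSup_of_mem ((γ.sd p : ℝ) + γ.sd q)
      (Submodule.mem_iSup_of_mem |(p.length : ℝ) - q.length|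
      (Submodule.mem_iSup_of_mem ⟨by positivity, by positivity, by positivity, h⟩ ?_)))
    exact Submodule.subset_span ⟨p, q, hpq, le_rfl, le_rfl, le_rfl, rfl⟩

theorem nbhd_anti {k k' : ℝ} (hk : 0 ≤ k) (h : k ≤ k') : γ.nbhd F k' ≤ γ.nbhd F k := by
  rw [nbhd_eq_span γ F hk, nbhd_eq_span γ F (hk.trans h)]
  refine Submodule.span_mono ?_
  rintro x ⟨p, q, hpq, hx, rfl⟩
  refine ⟨p, q, hpq, le_trans ?_ hx, rfl⟩
  exact mul_le_mul_of_nonneg_right h (by positivity)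

/-- The estimate for products of monomials. -/
theorem monomial_mul_bound (p q p' q' : G.Path) (hpq' : p'.tgt = q'.tgt) (hpq : p.tgt = q.tgt) :
    (monomial F p q * monomial F p' q' : G.Leavitt F) = 0 ∨
    ∃ a b : G.Path, a.tgt = b.tgt ∧
      (monomial F p q * monomial F p' q' : G.Leavitt F) = monomial F a b ∧
      ((p.length : ℝ) + q.length - |(p.length : ℝ) - q.length|) +
        ((p'.length : ℝ) + q'.length - |(p'.length : ℝ) - q'.length|) ≤
          2 * ((a.length : ℝ) + b.length) ∧
      (γ.sd a : ℝ) + γ.sd b ≤ ((γ.sd p : ℝ) + γ.sd q) + ((γ.sd p' : ℝ) + γ.sd q') ∧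
      |(a.length : ℝ) - b.length| ≤
        |(p.length : ℝ) - q.length| + |(p'.length : ℝ) - q'.length| := by
  rcases monomial_mul F p q p' q' hpq' hpq with h | ⟨a, m, ht, ha, hm, h⟩ | ⟨b, m, ht, hb, hm, h⟩
  · exact Or.inl h
  · right
    have l1 : (a.length : ℝ) = p.length + m.length := by simp [Path.length, ha]
    have l2 : (p'.length : ℝ) = q.length + m.length := by simp [Path.length, hm]
    have hm0 : (0 : ℝ) ≤ m.length := by positivity
    have s1 : γ.sd a ≤ γ.sd p + γ.sdList m := by
      rw [sd, ha]; exact γ.sdList_append_le _ _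
    have s2 : γ.sdList m ≤ γ.sd p' := by
      rw [sd, hm]; exact γ.sdList_le_append _ _
    refine ⟨a, q', ht, h, ?_, ?_, ?_⟩
    · have := neg_abs_le ((p.length : ℝ) - q.length)
      have := le_abs_self ((p'.length : ℝ) - q'.length)
      have := le_abs_self ((p.length : ℝ) - q.length)
      have := neg_abs_le ((p'.length : ℝ) - q'.length)
      linarith
    · norm_cast
      lia
    · rw [l1, l2, show (p.length : ℝ) + m.length - q'.length =
        (p.length - q.length) + (q.length + m.length - q'.length) by ring]
      exact abs_add_le _ _
  · right
    have l1 : (b.length : ℝ) = q'.length + m.length := by simp [Path.length, hb]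
    have l2 : (q.length : ℝ) = p'.length + m.length := by simp [Path.length, hm]
    have hm0 : (0 : ℝ) ≤ m.length := by positivity
    have s1 : γ.sd b ≤ γ.sd q' + γ.sdList m := by
      rw [sd, hb]; exact γ.sdList_append_le _ _
    have s2 : γ.sdList m ≤ γ.sd q := by
      rw [sd, hm]; exact γ.sdList_le_append _ _
    refine ⟨p, b, ht, h, ?_, ?_, ?_⟩
    · have := neg_abs_le ((p.length : ℝ) - q.length)
      have := le_abs_self ((p'.length : ℝ) - q'.length)
      have := le_abs_self ((p.length : ℝ) - q.length)
      have := neg_abs_le ((p'.length : ℝ) - q'.length)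
      linarith
    · norm_cast
      lia
    · rw [l1, l2, show (p.length : ℝ) - (q'.length + m.length) =
        (p.length - (p'.length + m.length)) + (p'.length - q'.length) by ring]
      exact abs_add_le _ _

theorem nbhd_mul {m : ℝ} (hm : 0 ≤ m) {x y : G.Leavitt F} (hx : x ∈ γ.nbhd F (2 * m + 1))
    (hy : y ∈ γ.nbhd F (2 * m + 1)) : x * y ∈ γ.nbhd F m := by
  have h := Submodule.mul_mem_mul hx hy
  rw [nbhd_eq_span γ F (by linarith), Submodule.span_mul_span] at h
  rw [nbhd_eq_span γ F hm]
  refine Submodule.span_le.2 ?_ h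
  rintro _ ⟨_, ⟨p, q, hpq, hi, rfl⟩, _, ⟨p', q', hpq', hj, rfl⟩, rfl⟩
  rcases monomial_mul_bound γ F p q p' q' hpq' hpq with h | ⟨a, b, hab, h, h1, h2, h3⟩
  · simp only [h]
    exact Submodule.zero_mem _
  · refine Submodule.subset_span ⟨a, b, hab, ?_, h⟩
    have k1 : (0 : ℝ) ≤ γ.sd p + γ.sd q := by positivity
    have k2 : (0 : ℝ) ≤ γ.sd p' + γ.sd q' := by positivity
    have k3 := mul_le_mul_of_nonneg_left h2 hm
    have k4 := mul_le_mul_of_nonneg_left h3 hm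
    nlinarith

theorem nbhd_mul_left (x : G.Leavitt F) {m : ℝ} (hm : 0 ≤ m) :
    ∃ k : ℝ, 0 ≤ k ∧ ∀ y ∈ γ.nbhd F k, x * y ∈ γ.nbhd F m := by
  let S : Subalgebra F (G.Leavitt F) :=
    { carrier := {x | ∀ m : ℝ, 0 ≤ m →
        ∃ k : ℝ, 0 ≤ k ∧ ∀ y ∈ γ.nbhd F k, x * y ∈ γ.nbhd F m}
      mul_mem' := by
        intro a b ha hb m hm
        obtain ⟨k, hk, h⟩ := ha m hm
        obtain ⟨k', hk', h'⟩ := hb k hk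
        exact ⟨k', hk', fun y hy => by rw [mul_assoc]; exact h _ (h' y hy)⟩
      add_mem' := by
        intro a b ha hb m hm
        obtain ⟨k, hk, h⟩ := ha m hm
        obtain ⟨k', hk', h'⟩ := hb m hm
        refine ⟨max k k', le_max_of_le_left hk, fun y hy => ?_⟩
        rw [add_mul]
        exact Submodule.add_mem _ (h y (γ.nbhd_anti F hk (le_max_left _ _) hy))
          (h' y (γ.nbhd_anti F hk' (le_max_right _ _) hy))
      algebraMap_mem' := by
        intro c m hm
        refine ⟨m, hm, fun y hy => ?_⟩
        rw [← Algebra.smul_def]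
        exact Submodule.smul_mem _ c hy }
  refine induction_alg F S ?_ x m hm
  intro p q hpq m hm
  set s0 : ℝ := (γ.sd p : ℝ) + γ.sd q with hs0
  set d0 : ℝ := |(p.length : ℝ) - q.length| with hd0
  have hs : 0 ≤ s0 := by positivity
  have hd : 0 ≤ d0 := by positivity
  have hk : 0 ≤ 2 * m * (s0 + d0 + 1) + d0 + 1 + 2 * m := by positivity
  refine ⟨_, hk, fun y hy => ?_⟩
  rw [nbhd_eq_span γ F hk] at hy
  induction hy using Submodule.span_induction with
  | zero => simp
  | add a b _ _ ha hb => rw [mul_add]; exact Submodule.add_mem _ ha hb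
  | smul c a _ ha => rw [mul_smul_comm]; exact Submodule.smul_mem _ c ha
  | mem y hy =>
    obtain ⟨p', q', hpq', hj, rfl⟩ := hy
    rcases monomial_mul_bound γ F p q p' q' hpq' hpq with h | ⟨a, b, hab, h, h1, h2, h3⟩
    · rw [h]; exact Submodule.zero_mem _
    · rw [h, nbhd_eq_span γ F hm]
      refine Submodule.subset_span ⟨a, b, hab, ?_, rfl⟩
      set s1 : ℝ := (γ.sd p' : ℝ) + γ.sd q'
      set d1 : ℝ := |(p'.length : ℝ) - q'.length|
      have hs1 : 0 ≤ s1 := by positivity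
      have hd1 : 0 ≤ d1 := by positivity
      have hl : (0 : ℝ) ≤ p.length + q.length := by positivity
      have k3 := mul_le_mul_of_nonneg_left h2 hm
      have k4 := mul_le_mul_of_nonneg_left h3 hm
      have k5 : 0 ≤ (2 * m * (s0 + d0 + 1) + d0) * (s1 + d1) := by positivity
      nlinarith

theorem nbhd_mul_right (x : G.Leavitt F) {m : ℝ} (hm : 0 ≤ m) :
    ∃ k : ℝ, 0 ≤ k ∧ ∀ y ∈ γ.nbhd F k, y * x ∈ γ.nbhd F m := by
  let S : Subalgebra F (G.Leavitt F) :=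
    { carrier := {x | ∀ m : ℝ, 0 ≤ m →
        ∃ k : ℝ, 0 ≤ k ∧ ∀ y ∈ γ.nbhd F k, y * x ∈ γ.nbhd F m}
      mul_mem' := by
        intro a b ha hb m hm
        obtain ⟨k, hk, h⟩ := hb m hm
        obtain ⟨k', hk', h'⟩ := ha k hk
        exact ⟨k', hk', fun y hy => by rw [← mul_assoc]; exact h _ (h' y hy)⟩
      add_mem' := by
        intro a b ha hb m hm
        obtain ⟨k, hk, h⟩ := ha m hm
        obtain ⟨k', hk', h'⟩ := hb m hm
        refine ⟨max k k', le_max_of_le_left hk, fun y hy => ?_⟩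
        rw [mul_add]
        exact Submodule.add_mem _ (h y (γ.nbhd_anti F hk (le_max_left _ _) hy))
          (h' y (γ.nbhd_anti F hk' (le_max_right _ _) hy))
      algebraMap_mem' := by
        intro c m hm
        refine ⟨m, hm, fun y hy => ?_⟩
        rw [← Algebra.commutes, ← Algebra.smul_def]
        exact Submodule.smul_mem _ c hy }
  refine induction_alg F S ?_ x m hm
  intro p q hpq m hm
  set s0 : ℝ := (γ.sd p : ℝ) + γ.sd q with hs0
  set d0 : ℝ := |(p.length : ℝ) - q.length| with hd0
  have hs : 0 ≤ s0 := by positivity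
  have hd : 0 ≤ d0 := by positivity
  have hk : 0 ≤ 2 * m * (s0 + d0 + 1) + d0 + 1 + 2 * m := by positivity
  refine ⟨_, hk, fun y hy => ?_⟩
  rw [nbhd_eq_span γ F hk] at hy
  induction hy using Submodule.span_induction with
  | zero => simp
  | add a b _ _ ha hb => rw [add_mul]; exact Submodule.add_mem _ ha hb
  | smul c a _ ha => rw [smul_mul_assoc]; exact Submodule.smul_mem _ c ha
  | mem y hy =>
    obtain ⟨p', q', hpq', hj, rfl⟩ := hy
    rcases monomial_mul_bound γ F p' q' p q hpq hpq' with h | ⟨a, b, hab, h, h1, h2, h3⟩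
    · rw [h]; exact Submodule.zero_mem _
    · rw [h, nbhd_eq_span γ F hm]
      refine Submodule.subset_span ⟨a, b, hab, ?_, rfl⟩
      set s1 : ℝ := (γ.sd p' : ℝ) + γ.sd q'
      set d1 : ℝ := |(p'.length : ℝ) - q'.length|
      have hs1 : 0 ≤ s1 := by positivity
      have hd1 : 0 ≤ d1 := by positivity
      have hl : (0 : ℝ) ≤ p.length + q.length := by positivity
      have k3 := mul_le_mul_of_nonneg_left h2 hm
      have k4 := mul_le_mul_of_nonneg_left h3 hm
      have k5 : 0 ≤ (2 * m * (s0 + d0 + 1) + d0) * (s1 + d1) := by positivity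
      nlinarith

/-- The decreasing sequence `V₁ ⊇ V₂ ⊇ ⋯`, which is cofinal among all `V_k` with real `k ≥ 1`. -/
noncomputable def nbhdSeq (k : ℕ) : AddSubgroup (G.Leavitt F) := (γ.nbhd F ((k : ℝ) + 1)).toAddSubgroup

theorem ringSubgroupsBasis : RingSubgroupsBasis (γ.nbhdSeq F) where
  inter i j := by
    refine ⟨max i j, le_inf ?_ ?_⟩
    · refine fun x hx => γ.nbhd_anti F (by positivity) ?_ hx
      gcongr
      exact le_max_left _ _
    · refine fun x hx => γ.nbhd_anti F (by positivity) ?_ hx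
      gcongr
      exact le_max_right _ _
  mul i := by
    refine ⟨2 * i + 2, ?_⟩
    rintro _ ⟨x, hx, y, hy, rfl⟩
    have h : 2 * ((i : ℝ) + 1) + 1 ≤ ((2 * i + 2 : ℕ) : ℝ) + 1 := by push_cast; linarith
    exact γ.nbhd_mul F (by positivity) (γ.nbhd_anti F (by positivity) h hx)
      (γ.nbhd_anti F (by positivity) h hy)
  leftMul x i := by
    obtain ⟨k, hk, h⟩ := γ.nbhd_mul_left F x (m := (i : ℝ) + 1) (by positivity)
    obtain ⟨n, hn⟩ := exists_nat_ge k
    exact ⟨n, fun y hy => h y (γ.nbhd_anti F hk (by linarith) hy)⟩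
  rightMul x i := by
    obtain ⟨k, hk, h⟩ := γ.nbhd_mul_right F x (m := (i : ℝ) + 1) (by positivity)
    obtain ⟨n, hn⟩ := exists_nat_ge k
    exact ⟨n, fun y hy => h y (γ.nbhd_anti F hk (by linarith) hy)⟩

/-- The Leavitt path algebra, to be equipped with the topology defined by `γ`. -/
def TopLeavitt (_γ : G.Specialization) : Type _ := G.Leavitt F

noncomputable instance : Ring (γ.TopLeavitt F) := inferInstanceAs (Ring (G.Leavitt F))

noncomputable instance : Algebra F (γ.TopLeavitt F) := inferInstanceAs (Algebra F (G.Leavitt F))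

/-- The topology in which the subspaces `V_k`, `k ≥ 1`, form a basis of neighborhoods of `0`. -/
noncomputable instance : TopologicalSpace (γ.TopLeavitt F) := (γ.ringSubgroupsBasis F).topology

instance : IsTopologicalRing (γ.TopLeavitt F) :=
  (γ.ringSubgroupsBasis F).toRingFilterBasis.isTopologicalRing

noncomputable instance : UniformSpace (γ.TopLeavitt F) :=
  IsTopologicalAddGroup.rightUniformSpace (γ.TopLeavitt F)

instance : IsUniformAddGroup (γ.TopLeavitt F) := isUniformAddGroup_of_addCommGroup

instance : UniformContinuousConstSMul F (γ.TopLeavitt F) where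
  uniformContinuous_const_smul c := by
    have h : (fun x : γ.TopLeavitt F => c • x) = fun x => algebraMap F _ c * x := by
      funext x
      exact Algebra.smul_def c x
    change UniformContinuous (fun x : γ.TopLeavitt F => c • x)
    rw [h]
    exact uniformContinuous_addMonoidHom_of_continuous
      (f := AddMonoidHom.mulLeft (algebraMap F (γ.TopLeavitt F) c))
      (continuous_const.mul continuous_id)

/-- The completion of the topological algebra `L(Γ)`. -/
abbrev LBar : Type _ := UniformSpace.Completion (γ.TopLeavitt F)

/-- The canonical linear map from `L(Γ)` to its completion. -/
noncomputable def toLBar : G.Leavitt F →ₗ[F] γ.LBar F where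
  toFun x := ((show γ.TopLeavitt F from x : γ.TopLeavitt F) : γ.LBar F)
  map_add' x y := UniformSpace.Completion.coe_add (α := γ.TopLeavitt F) x y
  map_smul' c x := UniformSpace.Completion.coe_smul (X := γ.TopLeavitt F) c x

theorem toLBar_mul (x y : G.Leavitt F) : γ.toLBar F (x * y) = γ.toLBar F x * γ.toLBar F y :=
  UniformSpace.Completion.coe_mul (α := γ.TopLeavitt F) x y

theorem toLBar_one : γ.toLBar F 1 = 1 := UniformSpace.Completion.coe_one (γ.TopLeavitt F)

/-- The completion of the homogeneous component of degree `i`, that is, its closure in the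
completion of `L(Γ)`. -/
noncomputable def componentBar (i : ℤ) : Submodule F (γ.LBar F) :=
  ((component G F i).map (γ.toLBar F)).topologicalClosure

theorem componentBar_mul {i j : ℤ} {x y : γ.LBar F} (hx : x ∈ γ.componentBar F i)
    (hy : y ∈ γ.componentBar F j) : x * y ∈ γ.componentBar F (i + j) := by
  refine map_mem_closure₂ (f := fun a b : γ.LBar F => a * b) continuous_mul hx hy ?_
  rintro _ ⟨a, ha, rfl⟩ _ ⟨b, hb, rfl⟩
  exact ⟨a * b, component_mul F ha hb, γ.toLBar_mul F a b⟩

theorem toLBar_mem_componentBar {i : ℤ} {x : G.Leavitt F} (hx : x ∈ component G F i) :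
    γ.toLBar F x ∈ γ.componentBar F i :=
  Submodule.le_topologicalClosure _ ⟨x, hx, rfl⟩

/-- The graded completion of `L(Γ)`: the sum of the completions of the homogeneous components,
with the topology induced by the completion of `L(Γ)`. -/
noncomputable def LHat : Subalgebra F (γ.LBar F) :=
  (⨆ i, γ.componentBar F i).toSubalgebra
    (Submodule.mem_iSup_of_mem 0
      (γ.toLBar_one F ▸ γ.toLBar_mem_componentBar F (one_mem_component F)))
    (by
      intro x y hx hy
      have h := Submodule.mul_mem_mul hx hy
      rw [Submodule.iSup_mul] at h
      refine (show _ ≤ ⨆ i, γ.componentBar F i from iSup_le fun i => ?_) h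
      rw [Submodule.mul_iSup]
      refine iSup_le fun j => ?_
      rw [Submodule.mul_le]
      exact fun a ha b hb => Submodule.mem_iSup_of_mem (i + j) (γ.componentBar_mul F ha hb))

/-- The homogeneous component of degree `i` of the graded completion. -/
noncomputable def componentHat (i : ℤ) : Submodule F (γ.LHat F) :=
  (γ.componentBar F i).comap (γ.LHat F).val.toLinearMap

/-- A vertex as an element of the graded completion. -/
noncomputable def vtxHat (v : V) : γ.LHat F :=
  ⟨γ.toLBar F (vtx F v),
    Submodule.mem_iSup_of_mem 0 (γ.toLBar_mem_componentBar F (vtx_mem_component F v))⟩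

/-- The closed two-sided ideals of the graded completion which contain the set `W` of vertices. -/
def closedIdeals (W : Set V) : Set (Submodule F (γ.LHat F)) :=
  {J | IsClosed (J : Set (γ.LHat F)) ∧ (∀ a, ∀ b ∈ J, a * b ∈ J ∧ b * a ∈ J) ∧
    ∀ w ∈ W, γ.vtxHat F w ∈ J}

/-- The closed two-sided ideal `I(W)` of the graded completion generated by the set `W` of
vertices, regarded as an algebra of its own (which is not assumed to have a unit). -/
noncomputable def idealI (W : Set V) : NonUnitalSubalgebra F (γ.LHat F) :=
  (sInf (γ.closedIdeals F W)).toNonUnitalSubalgebra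
    (by
      intro a b _ hb
      rw [Submodule.mem_sInf] at hb ⊢
      exact fun J hJ => (hJ.2.1 a b (hb J hJ)).1)

/-- The homogeneous component of degree `i` of `I(W)`. -/
noncomputable def idealIComponent (W : Set V) (i : ℤ) : Submodule F (γ.idealI F W) where
  carrier := {x | (x : γ.LHat F) ∈ γ.componentHat F i}
  zero_mem' := (γ.componentHat F i).zero_mem
  add_mem' := (γ.componentHat F i).add_mem
  smul_mem' c _ h := (γ.componentHat F i).smul_mem c h

end Specialization

end DirGraph

/-- A (not necessarily unital) topological algebra `A` with subspaces `𝒜 i`, `i ∈ ℤ`, is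
topologically graded simple if it is graded by them, its multiplication is not identically zero,
and it has no closed graded two-sided ideals except zero and itself. An ideal is graded if it is
spanned by its homogeneous elements. -/
structure IsTopologicallyGradedSimple (F : Type*) {A : Type*} [Field F] [NonUnitalRing A]
    [Module F A] [TopologicalSpace A] (𝒜 : ℤ → Submodule F A) : Prop where
  isInternal : DirectSum.IsInternal 𝒜
  mul_mem : ∀ i j, ∀ a ∈ 𝒜 i, ∀ b ∈ 𝒜 j, a * b ∈ 𝒜 (i + j)
  exists_mul_ne_zero : ∃ a b : A, a * b ≠ 0
  simple : ∀ J : Submodule F A, IsClosed (J : Set A) → (∀ a, ∀ b ∈ J, a * b ∈ J ∧ b * a ∈ J) →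
    (⨆ i, J ⊓ 𝒜 i) = J → J = ⊥ ∨ J = ⊤

/-!
The key is an idempotent `e_v` of the graded completion for every vertex `v`: the limit of
`r r*`, where `r` is the special path of length `n` with source `v`, as `n` tends to infinity
(`DirGraph.Specialization.idem`). The limit exists because consecutive terms differ by a sum of
elements `q q*`, where the last edge of `q` is not special. It satisfies `e_v = z e_w z*` for a
special edge `z` from `v` to `w`, whereas edges that are not special are annihilated by it.
Two consequences drive the proof.

* For a hereditary set `W`, the closed ideal generated by the `e_v`, `v ∈ W`, contains `W`, since
  `v` is the sum of the `p p*` over the paths `p` of length `N`, and `p p*` is close to `p e_w p*`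
  for large `N` (`vtxHat_mem_of_forall_idem`).
* The corner `e_v A_j e_w` of each homogeneous component `A_j` has dimension at most one and is
  spanned by an element `p e_u q*` (`exists_star_mul_mul_real_eq_smul_idem`).

Let `J` be a closed graded ideal of `I(W)` and `a ≠ 0` a homogeneous element of `J`. If all
`e_v x a y e_w` were zero, then `I(W) a I(W) = 0` by the first fact. This implies `a = 0`: the sums
`P_n` of `q q*` over the paths `q` of length at most `n` which meet `W` only in their target are an
approximate unit of `I(W)`, because the first condition of regularity bounds the special final
segments of these paths, so that multiplications by `P_n` are equicontinuous
(`IsRegular.exists_exhaustSum_mul_mem`). So some `e_v x a y e_w` is nonzero, and by the second fact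
`e_u ∈ J` for some `u ∈ W`. By the connectedness in the definition of regularity and
`e_v = z e_w z*`, all `e_v`, `v ∈ W`, lie in `J`, and hence `J = I(W)`.

The grading comes from the homomorphism to Laurent polynomials that multiplies elements of degree
`i` by the `i`-th power of the indeterminate; the coefficients are continuous projections. That the
multiplication of `I(W)` is not zero means that vertices do not lie in all neighborhoods of zero.
This is seen in a representation, a matrix coefficient of which vanishes on `V₂` but not on
the vertex (`vtx_notMem_nbhd`).
-/

namespace DirGraph

variable {V E : Type*} {G : DirGraph V E}

/-! ### Generators and relations of the Leavitt path algebra -/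

namespace Leavitt

variable {F : Type*} [Field F] [Fintype V] [Fintype E]

/-- The homomorphism out of the Leavitt path algebra given by the images of the generators. -/
noncomputable def lift {B : Type*} [Ring B] [Algebra F B] (g : Gen V E → B)
    (h : ∀ ⦃x y⦄, G.LeavittRel F x y → FreeAlgebra.lift F g x = FreeAlgebra.lift F g y) :
    G.Leavitt F →ₐ[F] B :=
  RingQuot.liftAlgHom F ⟨FreeAlgebra.lift F g, h⟩

theorem lift_mk {B : Type*} [Ring B] [Algebra F B] (g : Gen V E → B)
    (h : ∀ ⦃x y⦄, G.LeavittRel F x y → FreeAlgebra.lift F g x = FreeAlgebra.lift F g y)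
    (x : Gen V E) : lift g h (mk G F (FreeAlgebra.ι F x)) = g x :=
  (RingQuot.liftAlgHom_mkAlgHom_apply F _ h _).trans (FreeAlgebra.lift_ι_apply g x)

theorem vtx_mul_edge_of_ne {v : V} {e : E} (h : v ≠ G.s e) :
    (vtx F v * edge F e : G.Leavitt F) = 0 := by
  rw [← vtx_mul_edge, ← mul_assoc, vtx_mul_vtx F h, zero_mul]

theorem ghost_mul_vtx_of_ne {v : V} {e : E} (h : G.s e ≠ v) :
    (ghost F e * vtx F v : G.Leavitt F) = 0 := by
  rw [← ghost_mul_vtx, mul_assoc, vtx_mul_vtx F h, mul_zero]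

open Classical in
theorem vtx_eq_sum {v : V} (h : ¬ G.IsSink v) :
    (vtx F v : G.Leavitt F) = ∑ e : E with G.s e = v, edge F e * ghost F e := by
  simpa [vtx, edge, ghost] using rel F (LeavittRel.vtx_eq_sum (G := G) v h)

theorem real_singleton (e : E) : (real F (G.s e) [e] : G.Leavitt F) = edge F e := by
  simp [real, vtx_mul_edge]

theorem star_singleton (e : E) : (star F (G.s e) [e] : G.Leavitt F) = ghost F e := by
  simp [star, ghost_mul_vtx]

theorem real_nil (v : V) : (real F v [] : G.Leavitt F) = vtx F v := by simp [real]

theorem star_nil (v : V) : (star F v [] : G.Leavitt F) = vtx F v := by simp [star]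

theorem star_mul_real_self {u v : V} {l : List E} (h : G.IsWalk u l v) :
    (star F u l * real F u l : G.Leavitt F) = vtx F v := by
  induction l generalizing u with
  | nil => obtain rfl : u = v := h
           simp [real, star, vtx_mul_self]
  | cons e l ih =>
    obtain ⟨rfl, h⟩ := h
    rw [star_cons, real_cons, mul_assoc, ← mul_assoc (ghost F e), ghost_mul_edge_self,
      vtx_mul_real, ih h]

theorem span_monomial :
    Submodule.span F {x : G.Leavitt F | ∃ p q : G.Path, p.tgt = q.tgt ∧ x = monomial F p q} = ⊤ := by
  rw [eq_top_iff]
  have h1 : (1 : G.Leavitt F) ∈ Submodule.span F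
      {x : G.Leavitt F | ∃ p q : G.Path, p.tgt = q.tgt ∧ x = monomial F p q} := by
    rw [one_eq]
    exact Submodule.sum_mem _ fun v _ => Submodule.subset_span
      ⟨nilPath v, nilPath v, rfl, vtx_eq_monomial F v⟩
  intro x _
  refine induction_alg F (Submodule.toSubalgebra _ h1 ?_) (fun p q h => ?_) x
  · intro x y hx hy
    have h := Submodule.mul_mem_mul hx hy
    rw [Submodule.span_mul_span] at h
    refine Submodule.span_le.2 ?_ h
    rintro _ ⟨_, ⟨p, q, hpq, rfl⟩, _, ⟨p', q', hpq', rfl⟩, rfl⟩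
    rcases monomial_mul F p q p' q' hpq' hpq with h | ⟨a, m, ht, -, -, h⟩ | ⟨b, m, ht, -, -, h⟩
    · simp only [h]
      exact Submodule.zero_mem _
    · exact Submodule.subset_span ⟨a, q', ht, h⟩
    · exact Submodule.subset_span ⟨p, b, ht, h⟩
  · exact Submodule.subset_span ⟨p, q, h, rfl⟩

theorem iSup_component : ⨆ i, component G F i = ⊤ := by
  rw [eq_top_iff, ← span_monomial, Submodule.span_le]
  rintro _ ⟨p, q, h, rfl⟩
  exact Submodule.mem_iSup_of_mem ((p.length : ℤ) - q.length)
    (Submodule.subset_span ⟨p, q, h, rfl, rfl⟩)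

/-! ### The grading -/

/-- The images of the generators under the homomorphism that multiplies the elements of degree
`i` by the `i`-th power of an indeterminate. -/
noncomputable def gradingGen : Gen V E → AddMonoidAlgebra (G.Leavitt F) ℤ
  | .vtx v => .single 0 (vtx F v)
  | .edge e => .single 1 (edge F e)
  | .ghost e => .single (-1) (ghost F e)

theorem lift_gradingGen ⦃x y : FreeAlgebra F (Gen V E)⦄ (h : G.LeavittRel F x y) :
    FreeAlgebra.lift F (gradingGen (G := G) (F := F)) x = FreeAlgebra.lift F gradingGen y := by
  classical
  have hs (s : Finset E) (f : E → G.Leavitt F) :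
      (AddMonoidAlgebra.single (0 : ℤ) (∑ e ∈ s, f e)) = ∑ e ∈ s, .single 0 (f e) :=
    map_sum (AddMonoidAlgebra.singleAddHom (0 : ℤ)) f s
  have hs' (f : V → G.Leavitt F) :
      (AddMonoidAlgebra.single (0 : ℤ) (∑ v, f v)) = ∑ v, .single 0 (f v) :=
    map_sum (AddMonoidAlgebra.singleAddHom (0 : ℤ)) f _
  cases h <;> simp only [map_mul, map_sum, map_zero, map_one, FreeAlgebra.lift_ι_apply, gradingGen,
    AddMonoidAlgebra.single_mul_single, add_zero, zero_add, neg_add_cancel, add_neg_cancel]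
  case vtx_mul_self v => rw [Leavitt.vtx_mul_self]
  case vtx_mul_vtx v w h => rw [Leavitt.vtx_mul_vtx F h, AddMonoidAlgebra.single_zero]
  case vtx_mul_edge e => rw [Leavitt.vtx_mul_edge]
  case edge_mul_vtx e => rw [Leavitt.edge_mul_vtx]
  case vtx_mul_ghost e => rw [Leavitt.vtx_mul_ghost]
  case ghost_mul_vtx e => rw [Leavitt.ghost_mul_vtx]
  case ghost_mul_edge_self e => rw [Leavitt.ghost_mul_edge_self]
  case ghost_mul_edge e f h => rw [Leavitt.ghost_mul_edge F h, AddMonoidAlgebra.single_zero]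
  case vtx_eq_sum v h => rw [Leavitt.vtx_eq_sum h, hs]
  case one => rw [← hs', ← one_eq, AddMonoidAlgebra.one_def]

/-- The homomorphism to Laurent polynomials that multiplies the elements of degree `i` by the
`i`-th power of the indeterminate. -/
noncomputable def gradingHom : G.Leavitt F →ₐ[F] AddMonoidAlgebra (G.Leavitt F) ℤ :=
  lift gradingGen lift_gradingGen

theorem gradingHom_vtx (v : V) :
    gradingHom (vtx F v : G.Leavitt F) = .single 0 (vtx F v) := lift_mk _ _ _

theorem gradingHom_edge (e : E) :
    gradingHom (edge F e : G.Leavitt F) = .single 1 (edge F e) := lift_mk _ _ _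

theorem gradingHom_ghost (e : E) :
    gradingHom (ghost F e : G.Leavitt F) = .single (-1) (ghost F e) := lift_mk _ _ _

theorem gradingHom_monomial (p q : G.Path) :
    gradingHom (monomial F p q) = .single ((p.length : ℤ) - q.length) (monomial F p q) := by
  have hr (l : List E) : gradingHom ((l.map (edge F)).prod : G.Leavitt F) =
      .single (l.length : ℤ) (l.map (edge F)).prod := by
    induction l with
    | nil =>
      rw [List.map_nil, List.prod_nil, map_one, AddMonoidAlgebra.one_def, List.length_nil,
        Nat.cast_zero]
    | cons e l ih =>
      rw [List.map_cons, List.prod_cons, map_mul, gradingHom_edge, ih,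
        AddMonoidAlgebra.single_mul_single, List.length_cons, Nat.cast_succ, add_comm]
  have hg (l : List E) : gradingHom ((l.map (ghost F)).prod : G.Leavitt F) =
      .single (-l.length : ℤ) (l.map (ghost F)).prod := by
    induction l with
    | nil =>
      rw [List.map_nil, List.prod_nil, map_one, AddMonoidAlgebra.one_def, List.length_nil,
        Nat.cast_zero, neg_zero]
    | cons e l ih =>
      rw [List.map_cons, List.prod_cons, map_mul, gradingHom_ghost, ih,
        AddMonoidAlgebra.single_mul_single, List.length_cons, Nat.cast_succ, neg_add_rev]
  simp only [monomial, real, star, map_mul, hr, hg, gradingHom_vtx,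
    AddMonoidAlgebra.single_mul_single, Path.length, List.length_reverse]
  congr 1
  lia

/-- The projection of the Leavitt path algebra to its homogeneous component of degree `i`. -/
noncomputable def proj (i : ℤ) : G.Leavitt F →+ G.Leavitt F where
  toFun x := (gradingHom x).coeff i
  map_zero' := by simp
  map_add' := by simp

theorem gradingHom_of_mem {i : ℤ} {x : G.Leavitt F} (hx : x ∈ component G F i) :
    gradingHom x = .single i x := by
  induction hx using Submodule.span_induction with
  | zero => simp
  | add x y _ _ hx hy => rw [map_add, hx, hy, AddMonoidAlgebra.single_add]
  | smul c x _ hx => rw [map_smul, hx, AddMonoidAlgebra.smul_single]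
  | mem x hx =>
    obtain ⟨p, q, -, rfl, rfl⟩ := hx
    exact gradingHom_monomial p q

theorem proj_of_mem {i : ℤ} {x : G.Leavitt F} (hx : x ∈ component G F i) : proj i x = x := by
  change (gradingHom x).coeff i = x
  rw [gradingHom_of_mem hx, AddMonoidAlgebra.coeff_single, Finsupp.single_eq_same]

theorem proj_of_mem_ne {i j : ℤ} (h : i ≠ j) {x : G.Leavitt F} (hx : x ∈ component G F i) :
    proj j x = 0 := by
  change (gradingHom x).coeff j = 0
  rw [gradingHom_of_mem hx, AddMonoidAlgebra.coeff_single, Finsupp.single_eq_of_ne h.symm]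

/-- A subspace which contains the monomials of degree `i` in `T` contains the components of degree
`i` of all elements of the span of `T`. -/
theorem proj_mem_of_forall_monomial (S : Submodule F (G.Leavitt F)) {T : Set (G.Leavitt F)}
    (hT : ∀ x ∈ T, ∃ p q : G.Path, p.tgt = q.tgt ∧ x = monomial F p q) (i : ℤ)
    (hS : ∀ p q : G.Path, p.tgt = q.tgt → monomial F p q ∈ T → (p.length : ℤ) - q.length = i →
      monomial F p q ∈ S)
    {x : G.Leavitt F} (hx : x ∈ Submodule.span F T) : proj i x ∈ S := by
  induction hx using Submodule.span_induction with
  | zero => simp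
  | add x y _ _ hx hy => rw [map_add]; exact S.add_mem hx hy
  | smul c x _ hx =>
    have : proj i (c • x) = c • proj i x := by simp [proj]
    rw [this]
    exact S.smul_mem c hx
  | mem x hx =>
    obtain ⟨p, q, hpq, rfl⟩ := hT x hx
    have hmem : monomial F p q ∈ component G F ((p.length : ℤ) - q.length) :=
      Submodule.subset_span ⟨p, q, hpq, rfl, rfl⟩
    by_cases h : (p.length : ℤ) - q.length = i
    · rw [proj_of_mem (h ▸ hmem)]
      exact hS p q hpq hx h
    · rw [proj_of_mem_ne h hmem]
      exact S.zero_mem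

theorem proj_mem (i : ℤ) (x : G.Leavitt F) : proj i x ∈ component G F i :=
  proj_mem_of_forall_monomial (T := {x | ∃ p q : G.Path, p.tgt = q.tgt ∧ x = monomial F p q}) _
    (fun _ hx => hx) i
    (fun p q hpq _ h => by exact Submodule.subset_span ⟨p, q, hpq, h, rfl⟩)
    (by rw [span_monomial]; exact Submodule.mem_top)

theorem proj_mul_left {i j : ℤ} {a : G.Leavitt F} (ha : a ∈ component G F j) (x : G.Leavitt F) :
    proj i (a * x) = a * proj (i - j) x := by
  change (gradingHom (a * x)).coeff i = a * (gradingHom x).coeff (i - j)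
  rw [map_mul, gradingHom_of_mem ha, AddMonoidAlgebra.coeff_single_mul_apply, neg_add_eq_sub]

theorem proj_mul_right {i j : ℤ} {a : G.Leavitt F} (ha : a ∈ component G F j) (x : G.Leavitt F) :
    proj i (x * a) = proj (i - j) x * a := by
  change (gradingHom (x * a)).coeff i = (gradingHom x).coeff (i - j) * a
  rw [map_mul, gradingHom_of_mem ha, AddMonoidAlgebra.coeff_mul_single_apply, sub_eq_add_neg]

end Leavitt

/-! ### A representation of the Leavitt path algebra -/

/-- The data of a representation of the Leavitt path algebra on the functions on `V × ℕ`: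
injections `b e : ℕ → ℕ`, such that for every non-sink `v` the images of the `b e` with
`s(e) = v` are a partition of `ℕ`, and that `0` lies in the image of the special edge. -/
structure Branching (γ : G.Specialization) where
  toFun : E → ℕ → ℕ
  inj : ∀ {e f m n}, G.s e = G.s f → toFun e m = toFun f n → e = f ∧ m = n
  surj : ∀ {v}, ¬ G.IsSink v → ∀ n, ∃ e m, G.s e = v ∧ toFun e m = n
  special : ∀ {e}, γ.IsSpecial e → toFun e 0 = 0

theorem Specialization.IsSpecial.eq {γ : G.Specialization} {e f : E} (he : γ.IsSpecial e)
    (hf : γ.IsSpecial f) (h : G.s e = G.s f) : e = f := by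
  obtain ⟨v, rfl⟩ := he
  obtain ⟨w, rfl⟩ := hf
  rw [γ.s_toFun, γ.s_toFun] at h
  rw [Subtype.ext h]

/-- Both `{e // s(e) = v} × ℕ` and `ℕ` are countably infinite, and a transposition achieves the
condition on the special edge. -/
theorem Branching.nonempty [Finite E] (γ : G.Specialization) : Nonempty (Branching γ) := by
  have h (v : {v // ¬ G.IsSink v}) : ∃ σ : {e // G.s e = v} × ℕ ≃ ℕ,
      σ (⟨γ.toFun v, γ.s_toFun v⟩, 0) = 0 := by
    have : Nonempty {e // G.s e = v} := ⟨⟨γ.toFun v, γ.s_toFun v⟩⟩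
    obtain ⟨σ⟩ := nonempty_equiv_of_countable (α := {e // G.s e = v} × ℕ) (β := ℕ)
    exact ⟨σ.trans (Equiv.swap (σ (⟨γ.toFun v, γ.s_toFun v⟩, 0)) 0), by simp⟩
  choose σ hσ using h
  have hs (e : E) : ¬ G.IsSink (G.s e) := fun h => h e rfl
  have cast (e : E) (n : ℕ) {w : V} (hw : G.s e = w) (hw' : ¬ G.IsSink w) :
      σ ⟨G.s e, hs e⟩ (⟨e, rfl⟩, n) = σ ⟨w, hw'⟩ (⟨e, hw⟩, n) := by
    subst hw
    rfl
  refine ⟨⟨fun e m => σ ⟨G.s e, hs e⟩ (⟨e, rfl⟩, m), ?_, ?_, ?_⟩⟩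
  · intro e f m n hef h
    have := (σ _).injective (h.trans (cast f n hef.symm (hs e)))
    simpa using this
  · intro v hv n
    obtain ⟨⟨⟨e, he⟩, m⟩, h⟩ := (σ ⟨v, hv⟩).surjective n
    exact ⟨e, m, he, (cast e m he hv).trans h⟩
  · rintro _ ⟨v, rfl⟩
    exact (cast _ 0 (γ.s_toFun v) v.2).trans (hσ v)

namespace Branching

variable {γ : G.Specialization} (b : Branching γ) (F : Type*) [Field F]

open Classical in
/-- The action of an edge `e` on the functions on `V × ℕ`: the transport of the part at `r(e)`
along `b e` to a function supported on the image of `b e` at `s(e)`. -/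
noncomputable def edgeOp (e : E) : Module.End F (V × ℕ → F) where
  toFun g x := if h : ∃ m, G.s e = x.1 ∧ b.toFun e m = x.2 then g (G.r e, h.choose) else 0
  map_add' g g' := by ext x; dsimp; split_ifs <;> simp
  map_smul' c g := by ext x; dsimp; split_ifs <;> simp

open Classical in
/-- The action of `e*` on the functions on `V × ℕ`. -/
noncomputable def ghostOp (e : E) : Module.End F (V × ℕ → F) where
  toFun g x := if x.1 = G.r e then g (G.s e, b.toFun e x.2) else 0
  map_add' g g' := by ext x; dsimp; split_ifs <;> simp
  map_smul' c g := by ext x; dsimp; split_ifs <;> simp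

open Classical in
/-- The action of a vertex on the functions on `V × ℕ`. -/
noncomputable def vtxOp (v : V) : Module.End F (V × ℕ → F) where
  toFun g x := if x.1 = v then g x else 0
  map_add' g g' := by ext x; dsimp; split_ifs <;> simp
  map_smul' c g := by ext x; dsimp; split_ifs <;> simp

open Classical in
theorem vtxOp_apply (v : V) (g : V × ℕ → F) (x : V × ℕ) :
    vtxOp F v g x = if x.1 = v then g x else 0 := rfl

open Classical in
theorem ghostOp_apply (e : E) (g : V × ℕ → F) (x : V × ℕ) :
    b.ghostOp F e g x = if x.1 = G.r e then g (G.s e, b.toFun e x.2) else 0 := rfl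

theorem edgeOp_apply_self (e : E) (g : V × ℕ → F) (m : ℕ) :
    b.edgeOp F e g (G.s e, b.toFun e m) = g (G.r e, m) := by
  have h : ∃ m', G.s e = (G.s e, b.toFun e m).1 ∧ b.toFun e m' = (G.s e, b.toFun e m).2 :=
    ⟨m, rfl, rfl⟩
  refine (dif_pos h).trans ?_
  rw [(b.inj rfl h.choose_spec.2).2]

theorem edgeOp_apply_of_ne {e f : E} (hef : e ≠ f) (g : V × ℕ → F) (m : ℕ) :
    b.edgeOp F e g (G.s f, b.toFun f m) = 0 :=
  dif_neg fun ⟨_, h1, h2⟩ => hef (b.inj h1 h2).1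

theorem edgeOp_apply_of_source_ne {e : E} {x : V × ℕ} (h : G.s e ≠ x.1) (g : V × ℕ → F) :
    b.edgeOp F e g x = 0 :=
  dif_neg fun ⟨_, h1, _⟩ => h h1

/-- A branching defines operators that satisfy the relations of the Leavitt path algebra. -/
noncomputable def genOp : Gen V E → Module.End F (V × ℕ → F)
  | .vtx v => vtxOp F v
  | .edge e => b.edgeOp F e
  | .ghost e => b.ghostOp F e

variable [Fintype V] [Fintype E]

theorem lift_genOp ⦃x y : FreeAlgebra F (Gen V E)⦄ (h : G.LeavittRel F x y) :
    FreeAlgebra.lift F (b.genOp F) x = FreeAlgebra.lift F (b.genOp F) y := by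
  classical
  cases h <;> simp only [map_mul, map_sum, map_zero, map_one, FreeAlgebra.lift_ι_apply, genOp] <;>
    ext g ⟨u, n⟩ <;>
    simp only [Module.End.mul_apply, LinearMap.zero_apply, LinearMap.sum_apply, Finset.sum_apply,
      Pi.zero_apply, Module.End.one_apply, vtxOp_apply, ghostOp_apply]
  case vtx_mul_self v => split_ifs <;> rfl
  case vtx_mul_vtx v w h =>
    split_ifs with h1 h2
    · exact absurd (h1.symm.trans h2) h
    · rfl
    · rfl
  case vtx_mul_edge e =>
    split_ifs with h
    · rfl
    · exact (b.edgeOp_apply_of_source_ne F (Ne.symm h) g).symm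
  case edge_mul_vtx e =>
    by_cases h : ∃ m, G.s e = u ∧ b.toFun e m = n
    · obtain ⟨m, rfl, rfl⟩ := h
      rw [edgeOp_apply_self, edgeOp_apply_self, vtxOp_apply, if_pos rfl]
    · have h0 (g) : b.edgeOp F e g (u, n) = 0 := dif_neg h
      rw [h0, h0]
  case vtx_mul_ghost e => split_ifs <;> rfl
  case ghost_mul_vtx e => simp
  case ghost_mul_edge_self e =>
    split_ifs with h
    · rw [edgeOp_apply_self, h]
    · rfl
  case ghost_mul_edge e f h =>
    rw [edgeOp_apply_of_ne _ _ h.symm, ite_self]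
  case vtx_eq_sum v h =>
    split_ifs with huv
    · subst huv
      obtain ⟨f, m, rfl, rfl⟩ := b.surj h n
      rw [Finset.sum_eq_single_of_mem f (by simp)]
      · rw [edgeOp_apply_self, ghostOp_apply, if_pos rfl]
      · intro e _ hef
        exact edgeOp_apply_of_ne _ _ hef _ _
    · refine (Finset.sum_eq_zero fun e he => ?_).symm
      simp only [Finset.mem_filter, Finset.mem_univ, true_and] at he
      exact edgeOp_apply_of_source_ne _ _ (by rw [he]; exact Ne.symm huv) _
  case one => simp

/-- The representation of the Leavitt path algebra on the functions on `V × ℕ`. -/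
noncomputable def rep : G.Leavitt F →ₐ[F] Module.End F (V × ℕ → F) :=
  Leavitt.lift (b.genOp F) (b.lift_genOp F)

/-- The linear functional `x ↦ (x · 1)(v, 0)`, a matrix coefficient of the representation. The
point `(v, 0)` lies in the image of the special edge with source `v` only, and corresponds there to
a point of the same form. So the functional vanishes on `p q*` unless all edges of `p` are special. -/
noncomputable def coeff (v : V) : G.Leavitt F →ₗ[F] F where
  toFun x := b.rep F x 1 (v, 0)
  map_add' x y := by simp
  map_smul' c x := by simp

theorem coeff_vtx (v : V) : b.coeff F v (Leavitt.vtx F v) = 1 := by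
  change b.rep F (Leavitt.mk G F (FreeAlgebra.ι F (.vtx v))) 1 (v, 0) = 1
  rw [rep, Leavitt.lift_mk]
  exact if_pos rfl

theorem coeff_vtx_mul_of_ne {u v : V} (h : v ≠ u) (x : G.Leavitt F) :
    b.coeff F v (Leavitt.vtx F u * x) = 0 := by
  change b.rep F (Leavitt.mk G F (FreeAlgebra.ι F (.vtx u)) * x) 1 (v, 0) = 0
  rw [map_mul, rep, Leavitt.lift_mk]
  exact if_neg h

theorem coeff_edge_mul (e : E) (v : V) (x : G.Leavitt F) (h : b.coeff F v (Leavitt.edge F e * x) ≠ 0) :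
    γ.IsSpecial e ∧ v = G.s e ∧ b.coeff F (G.r e) x ≠ 0 := by
  by_cases hv : G.IsSink v
  · refine absurd ?_ h
    change b.rep F (Leavitt.mk G F (FreeAlgebra.ι F (.edge e)) * x) 1 (v, 0) = 0
    rw [map_mul, rep, Leavitt.lift_mk]
    exact b.edgeOp_apply_of_source_ne F (hv e) _
  have hs : γ.IsSpecial (γ.toFun ⟨v, hv⟩) := ⟨_, rfl⟩
  have key : b.coeff F v (Leavitt.edge F e * x) = b.edgeOp F e (b.rep F x 1)
      (G.s (γ.toFun ⟨v, hv⟩), b.toFun (γ.toFun ⟨v, hv⟩) 0) := by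
    rw [γ.s_toFun, b.special hs]
    change b.rep F (Leavitt.mk G F (FreeAlgebra.ι F (.edge e)) * x) 1 (v, 0) = _
    rw [map_mul, rep, Leavitt.lift_mk]
    rfl
  by_cases he : e = γ.toFun ⟨v, hv⟩
  · rw [← he, edgeOp_apply_self] at key
    refine ⟨he ▸ hs, ?_, ?_⟩
    · rw [he, γ.s_toFun]
    · rw [key] at h
      exact h
  · rw [edgeOp_apply_of_ne _ _ he] at key
    exact absurd key h

theorem special_of_coeff_ne_zero {u v : V} {l : List E} {x : G.Leavitt F}
    (h : b.coeff F v (Leavitt.real F u l * x) ≠ 0) : ∀ e ∈ l, γ.IsSpecial e := by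
  have hprod : ∀ (l : List E) (v : V),
      b.coeff F v ((l.map (Leavitt.edge F)).prod * x) ≠ 0 → ∀ e ∈ l, γ.IsSpecial e := by
    intro l
    induction l with
    | nil => simp
    | cons e l ih =>
      intro v h
      rw [List.map_cons, List.prod_cons, mul_assoc] at h
      obtain ⟨h1, -, h3⟩ := b.coeff_edge_mul F e v _ h
      exact List.forall_mem_cons.2 ⟨h1, ih _ h3⟩
  have huv : v = u := by
    by_contra hne
    rw [Leavitt.real, mul_assoc] at h
    exact h (b.coeff_vtx_mul_of_ne F hne _)
  subst huv
  refine hprod l v fun h0 => h ?_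
  rw [Leavitt.real, mul_assoc]
  change b.rep F (Leavitt.mk G F (FreeAlgebra.ι F (.vtx v)) * _) 1 (v, 0) = 0
  rw [map_mul, rep, Leavitt.lift_mk]
  exact (if_pos rfl).trans h0

end Branching

namespace Specialization

variable (γ : G.Specialization)

theorem sdList_of_forall {l : List E} (h : ∀ e ∈ l, γ.IsSpecial e) : γ.sdList l = l.length := by
  classical
  rw [sdList, List.rtakeWhile_eq_self_iff.2]
  simpa using h

theorem sdList_append_singleton_of_not {e : E} (h : ¬ γ.IsSpecial e) (l : List E) :
    γ.sdList (l ++ [e]) = 0 := by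
  classical
  rw [sdList, List.rtakeWhile_concat_neg]
  · rfl
  · simpa using h

theorem exists_eq_append (l : List E) :
    ∃ l₁ l₂ : List E, l = l₁ ++ l₂ ∧ l₂.length = γ.sdList l ∧ ∀ e ∈ l₂, γ.IsSpecial e := by
  classical
  refine ⟨l.rdropWhile fun e => decide (γ.IsSpecial e), l.rtakeWhile fun e => decide (γ.IsSpecial e),
    ?_, rfl, ?_⟩
  · simp [List.rdropWhile, List.rtakeWhile, ← List.reverse_append]
  · intro e he
    simpa using List.mem_rtakeWhile_imp he

variable (F : Type*) [Field F] [Fintype V] [Fintype E]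

/-- A vertex does not lie in `V₂`. Hence vertices are nonzero in the completion. -/
theorem vtx_notMem_nbhd (v : V) : Leavitt.vtx F v ∉ γ.nbhd F 2 := by
  obtain ⟨b⟩ := Branching.nonempty γ
  have h : γ.nbhd F 2 ≤ LinearMap.ker (b.coeff F v) := by
    rw [nbhd_eq_span γ F (by norm_num), Submodule.span_le]
    rintro _ ⟨p, q, -, h, rfl⟩
    by_contra hne
    have hp := γ.sdList_of_forall (b.special_of_coeff_ne_zero F hne)
    have h1 := le_abs_self ((p.length : ℝ) - q.length)
    have h2 := neg_abs_le ((p.length : ℝ) - q.length)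
    -- all edges of `p` are special, so that `l(q) ≤ l(p) + |l(p) - l(q)|` contradicts `h`
    have h3 : (γ.sd p : ℝ) = p.length := by
      rw [sd, hp, Path.length]
    have h4 : (0 : ℝ) ≤ γ.sd q := by positivity
    linarith
  intro hv
  have := h hv
  rw [LinearMap.mem_ker, b.coeff_vtx] at this
  exact one_ne_zero this

end Specialization

/-! ### The topology of the graded completion -/

theorem _root_.Filter.HasBasis.mem_closure_iff_sub {A ι : Type*} [AddCommGroup A]
    [TopologicalSpace A] [IsTopologicalAddGroup A] {p : ι → Prop} {U : ι → Set A}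
    (hU : (nhds (0 : A)).HasBasis p U) {S : Set A} {x : A} :
    x ∈ closure S ↔ ∀ i, p i → ∃ y ∈ S, x - y ∈ U i := by
  rw [mem_closure_iff_nhds]
  constructor
  · intro h i hi
    have hc : Filter.Tendsto (fun y => x - y) (nhds x) (nhds 0) := by
      have := (continuous_sub_left x).tendsto x
      rwa [sub_self] at this
    obtain ⟨y, hy, hyS⟩ := h _ (hc (hU.mem_of_mem hi))
    exact ⟨y, hyS, hy⟩
  · intro h O hO
    have hc : Filter.Tendsto (fun y => x - y) (nhds 0) (nhds x) := by
      have := (continuous_sub_left x).tendsto 0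
      rwa [sub_zero] at this
    obtain ⟨i, hi, hiO⟩ := hU.mem_iff.1 (hc hO)
    obtain ⟨y, hyS, hy⟩ := h i hi
    have := hiO hy
    rw [Set.mem_preimage, sub_sub_cancel] at this
    exact ⟨y, this, hyS⟩

namespace Specialization

open Leavitt Topology

variable (γ : G.Specialization) (F : Type*) [Field F] [Fintype V] [Fintype E]

theorem componentBar_le (i : ℤ) {x : γ.LBar F} (hx : x ∈ γ.componentBar F i) : x ∈ γ.LHat F :=
  Submodule.mem_iSup_of_mem (p := γ.componentBar F) i hx

theorem toLBar_mem_LHat (x : G.Leavitt F) : γ.toLBar F x ∈ γ.LHat F := by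
  have h : x ∈ ⨆ i, component G F i := by rw [iSup_component]; exact Submodule.mem_top
  induction h using Submodule.iSup_induction' with
  | mem i x hx => exact γ.componentBar_le F i (γ.toLBar_mem_componentBar F hx)
  | zero => rw [map_zero]; exact zero_mem _
  | add x y _ _ hx hy => rw [map_add]; exact add_mem hx hy

instance : IsTopologicalRing (γ.LHat F) where
  continuous_neg := (continuous_neg.comp continuous_subtype_val).subtype_mk _

/-- The canonical homomorphism from the Leavitt path algebra to its graded completion. -/
noncomputable def toLHat : G.Leavitt F →ₐ[F] γ.LHat F :=
  AlgHom.ofLinearMap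
    { toFun x := ⟨γ.toLBar F x, γ.toLBar_mem_LHat F x⟩
      map_add' x y := Subtype.ext (map_add _ x y)
      map_smul' c x := Subtype.ext (map_smul _ c x) }
    (Subtype.ext (γ.toLBar_one F))
    (fun x y => Subtype.ext (γ.toLBar_mul F x y))

theorem toLHat_vtx (v : V) : γ.toLHat F (vtx F v) = γ.vtxHat F v := rfl

/-- The closure of `V_k` in the graded completion. -/
noncomputable def nbhdHat (k : ℝ) : Submodule F (γ.LHat F) :=
  (((γ.nbhd F k).map (γ.toLBar F)).topologicalClosure).comap (γ.LHat F).val.toLinearMap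

theorem mem_closure_iff_coe {S : Set (G.Leavitt F)} {x : γ.LHat F} :
    x ∈ closure (γ.toLHat F '' S) ↔ (x : γ.LBar F) ∈ closure (γ.toLBar F '' S) := by
  rw [IsInducing.subtypeVal.closure_eq_preimage_closure_image, Set.mem_preimage, Set.image_image]
  rfl

theorem mem_componentHat_iff {i : ℤ} {x : γ.LHat F} :
    x ∈ γ.componentHat F i ↔ x ∈ closure (γ.toLHat F '' component G F i) :=
  (γ.mem_closure_iff_coe F).symm

theorem mem_nbhdHat_iff {k : ℝ} {x : γ.LHat F} :
    x ∈ γ.nbhdHat F k ↔ x ∈ closure (γ.toLHat F '' γ.nbhd F k) :=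
  (γ.mem_closure_iff_coe F).symm

theorem mem_closure_range_toLHat (x : γ.LHat F) : x ∈ closure (Set.range (γ.toLHat F)) := by
  rw [← Set.image_univ, mem_closure_iff_coe, Set.image_univ]
  exact UniformSpace.Completion.denseRange_coe (α := γ.TopLeavitt F) (x : γ.LBar F)

theorem isClosed_nbhdHat (k : ℝ) : IsClosed (γ.nbhdHat F k : Set (γ.LHat F)) := by
  have : (γ.nbhdHat F k : Set (γ.LHat F)) = closure (γ.toLHat F '' γ.nbhd F k) :=
    Set.ext fun _ => γ.mem_nbhdHat_iff F
  rw [this]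
  exact isClosed_closure

theorem toLHat_mem_nbhdHat {k : ℝ} {x : G.Leavitt F} (hx : x ∈ γ.nbhd F k) :
    γ.toLHat F x ∈ γ.nbhdHat F k :=
  (γ.mem_nbhdHat_iff F).2 (subset_closure ⟨x, hx, rfl⟩)

theorem toLHat_mem_componentHat {i : ℤ} {x : G.Leavitt F} (hx : x ∈ component G F i) :
    γ.toLHat F x ∈ γ.componentHat F i :=
  (γ.mem_componentHat_iff F).2 (subset_closure ⟨x, hx, rfl⟩)

theorem nbhdHat_anti {k k' : ℝ} (hk : 0 ≤ k) (h : k ≤ k') : γ.nbhdHat F k' ≤ γ.nbhdHat F k := by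
  intro x hx
  rw [mem_nbhdHat_iff] at hx ⊢
  exact closure_mono (Set.image_mono (γ.nbhd_anti F hk h)) hx

theorem hasBasis_nhds_zero_topLeavitt :
    (𝓝 (0 : γ.TopLeavitt F)).HasBasis (fun _ : ℕ => True)
      fun k => ((γ.nbhdSeq F k : Set (G.Leavitt F)) : Set (γ.TopLeavitt F)) :=
  (γ.ringSubgroupsBasis F).hasBasis_nhds_zero

theorem hasBasis_nhds_zero :
    (𝓝 (0 : γ.LHat F)).HasBasis (fun _ : ℕ => True) fun k => γ.nbhdHat F ((k : ℝ) + 1) := by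
  have h2 := (γ.hasBasis_nhds_zero_topLeavitt F).hasBasis_of_isDenseInducing
    (UniformSpace.Completion.isDenseInducing_coe (α := γ.TopLeavitt F))
  rw [UniformSpace.Completion.coe_zero] at h2
  rw [nhds_subtype]
  exact h2.comap _

theorem mem_closure_iff_sub_mem {S : Set (γ.LHat F)} {x : γ.LHat F} :
    x ∈ closure S ↔ ∀ k : ℝ, 0 ≤ k → ∃ y ∈ S, x - y ∈ γ.nbhdHat F k := by
  rw [(γ.hasBasis_nhds_zero F).mem_closure_iff_sub]
  constructor
  · intro h k hk
    obtain ⟨n, hn⟩ := exists_nat_ge k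
    obtain ⟨y, hy, hxy⟩ := h n trivial
    exact ⟨y, hy, γ.nbhdHat_anti F hk (by linarith) hxy⟩
  · intro h k _
    exact h _ (by positivity)

theorem eq_zero_of_forall_mem_nbhdHat {x : γ.LHat F}
    (h : ∀ k : ℝ, 0 ≤ k → x ∈ γ.nbhdHat F k) : x = 0 := by
  have : x ∈ closure ({0} : Set (γ.LHat F)) := by
    rw [mem_closure_iff_sub_mem]
    exact fun k hk => ⟨0, rfl, by rw [sub_zero]; exact h k hk⟩
  rwa [closure_singleton, Set.mem_singleton_iff] at this

theorem vtxHat_ne_zero (v : V) : γ.vtxHat F v ≠ 0 := by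
  intro h
  have h0 : γ.toLBar F (vtx F v) = ((0 : γ.TopLeavitt F) : γ.LBar F) :=
    (congrArg Subtype.val h).trans UniformSpace.Completion.coe_zero.symm
  have h1 : @id (γ.TopLeavitt F) (vtx F v) ∈ closure ({0} : Set (γ.TopLeavitt F)) := by
    rw [(UniformSpace.Completion.isDenseInducing_coe
      (α := γ.TopLeavitt F)).isInducing.closure_eq_preimage_closure_image]
    refine subset_closure ?_
    rw [Set.image_singleton, Set.mem_singleton_iff]
    exact h0
  obtain ⟨y, hy, hv⟩ := (γ.hasBasis_nhds_zero_topLeavitt F).mem_closure_iff_sub.1 h1 1 trivial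
  rw [Set.mem_singleton_iff.1 hy, sub_zero] at hv
  refine γ.vtx_notMem_nbhd F v ?_
  have h3 : vtx F v ∈ γ.nbhd F (((1 : ℕ) : ℝ) + 1) := hv
  norm_num at h3
  exact h3

theorem iSup_componentHat : ⨆ i, γ.componentHat F i = ⊤ := by
  rw [eq_top_iff]
  rintro ⟨x, hx⟩ -
  change x ∈ ⨆ i, γ.componentBar F i at hx
  induction hx using Submodule.iSup_induction' with
  | mem i x hx => exact Submodule.mem_iSup_of_mem (p := γ.componentHat F) i hx
  | zero => exact zero_mem _
  | add x y hx hy h h' => exact add_mem h h'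

theorem componentHat_mul {i j : ℤ} {x y : γ.LHat F} (hx : x ∈ γ.componentHat F i)
    (hy : y ∈ γ.componentHat F j) : x * y ∈ γ.componentHat F (i + j) :=
  γ.componentBar_mul F hx hy

/-! ### The projections to the homogeneous components -/

theorem proj_mem_nbhd (i : ℤ) {k : ℝ} (hk : 0 ≤ k) {x : G.Leavitt F} (hx : x ∈ γ.nbhd F k) :
    proj i x ∈ γ.nbhd F k := by
  rw [nbhd_eq_span γ F hk] at hx ⊢
  refine proj_mem_of_forall_monomial _ ?_ i (fun p q _ h _ => Submodule.subset_span h) hx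
  rintro _ ⟨p, q, hpq, -, rfl⟩
  exact ⟨p, q, hpq, rfl⟩

/-- The projection to the homogeneous component of degree `i`, as an endomorphism of the
topological group `L(Γ)`. -/
noncomputable def projTop (i : ℤ) : γ.TopLeavitt F →+ γ.TopLeavitt F :=
  show G.Leavitt F →+ G.Leavitt F from proj i

theorem continuous_projTop (i : ℤ) : Continuous (γ.projTop F i) := by
  refine continuous_of_continuousAt_zero _ ?_
  rw [ContinuousAt, map_zero]
  have h := γ.hasBasis_nhds_zero_topLeavitt F
  exact (h.tendsto_iff h).2 fun k _ => ⟨k, trivial, fun x hx =>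
    γ.proj_mem_nbhd F i (by positivity) hx⟩

/-- The continuous extension to the completion of the projection to the homogeneous component of
degree `i`. -/
noncomputable def projBar (i : ℤ) : γ.LBar F →+ γ.LBar F :=
  (γ.projTop F i).completion (γ.continuous_projTop F i)

theorem continuous_projBar (i : ℤ) : Continuous (γ.projBar F i) :=
  AddMonoidHom.continuous_completion _ _

theorem projBar_toLBar (i : ℤ) (x : G.Leavitt F) :
    γ.projBar F i (γ.toLBar F x) = γ.toLBar F (proj i x) :=
  AddMonoidHom.completion_coe (γ.projTop F i) (γ.continuous_projTop F i) x

theorem projBar_mem (i : ℤ) (x : γ.LBar F) : γ.projBar F i x ∈ γ.componentBar F i := by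
  have hcl : IsClosed {x | γ.projBar F i x ∈ γ.componentBar F i} :=
    (Submodule.isClosed_topologicalClosure _).preimage (γ.continuous_projBar F i)
  refine UniformSpace.Completion.induction_on x hcl fun y => ?_
  have := γ.projBar_toLBar F i y
  refine Set.mem_of_eq_of_mem this (γ.toLBar_mem_componentBar F (proj_mem i _))

/-- The projection of the graded completion to its homogeneous component of degree `i`. -/
noncomputable def projHat (i : ℤ) : γ.LHat F →+ γ.LHat F where
  toFun x := ⟨γ.projBar F i x, γ.componentBar_le F i (γ.projBar_mem F i x)⟩
  map_zero' := Subtype.ext (map_zero _)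
  map_add' _ _ := Subtype.ext (map_add _ _ _)

theorem continuous_projHat (i : ℤ) : Continuous (γ.projHat F i) :=
  ((γ.continuous_projBar F i).comp continuous_subtype_val).subtype_mk _

theorem projHat_toLHat (i : ℤ) (x : G.Leavitt F) :
    γ.projHat F i (γ.toLHat F x) = γ.toLHat F (proj i x) :=
  Subtype.ext (γ.projBar_toLBar F i x)

theorem projHat_mem (i : ℤ) (x : γ.LHat F) : γ.projHat F i x ∈ γ.componentHat F i :=
  γ.projBar_mem F i x

variable {γ F}

/-- A closed property which holds on the Leavitt path algebra holds on the graded completion. -/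
theorem LHat.induction {P : γ.LHat F → Prop} (hP : IsClosed {x | P x})
    (h : ∀ x, P (γ.toLHat F x)) (x : γ.LHat F) : P x := by
  refine closure_minimal ?_ hP (γ.mem_closure_range_toLHat F x)
  rintro _ ⟨y, rfl⟩
  exact h y

theorem componentHat_induction {i : ℤ} {P : γ.LHat F → Prop} (hP : IsClosed {x | P x})
    (h : ∀ x ∈ component G F i, P (γ.toLHat F x)) {x : γ.LHat F} (hx : x ∈ γ.componentHat F i) :
    P x := by
  refine closure_minimal ?_ hP ((γ.mem_componentHat_iff F).1 hx)
  rintro _ ⟨y, hy, rfl⟩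
  exact h y hy

theorem projHat_of_mem {i : ℤ} {x : γ.LHat F} (hx : x ∈ γ.componentHat F i) :
    γ.projHat F i x = x :=
  componentHat_induction (isClosed_eq (γ.continuous_projHat F i) continuous_id)
    (fun y hy => by rw [projHat_toLHat, proj_of_mem hy]; rfl) hx

theorem projHat_of_mem_ne {i j : ℤ} (hij : i ≠ j) {x : γ.LHat F} (hx : x ∈ γ.componentHat F i) :
    γ.projHat F j x = 0 :=
  componentHat_induction (isClosed_eq (γ.continuous_projHat F j) continuous_const)
    (fun y hy => by rw [projHat_toLHat, proj_of_mem_ne hij hy, map_zero]) hx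

theorem projHat_mul_left {i j : ℤ} {a : γ.LHat F} (ha : a ∈ γ.componentHat F j) (x : γ.LHat F) :
    γ.projHat F i (a * x) = a * γ.projHat F (i - j) x := by
  have hc := γ.continuous_projHat F
  refine LHat.induction (P := fun x => γ.projHat F i (a * x) = a * γ.projHat F (i - j) x)
    (isClosed_eq ((hc i).comp (continuous_const_mul a)) ((hc _).const_mul a)) (fun y => ?_) x
  refine componentHat_induction
    (P := fun a => γ.projHat F i (a * γ.toLHat F y) = a * γ.projHat F (i - j) (γ.toLHat F y))
    (isClosed_eq ((hc i).comp (continuous_mul_const _)) (continuous_mul_const _)) ?_ ha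
  intro b hb
  rw [← map_mul, projHat_toLHat, projHat_toLHat, proj_mul_left hb, map_mul]

theorem projHat_mul_right {i j : ℤ} {a : γ.LHat F} (ha : a ∈ γ.componentHat F j) (x : γ.LHat F) :
    γ.projHat F i (x * a) = γ.projHat F (i - j) x * a := by
  have hc := γ.continuous_projHat F
  refine LHat.induction (P := fun x => γ.projHat F i (x * a) = γ.projHat F (i - j) x * a)
    (isClosed_eq ((hc i).comp (continuous_mul_const a)) ((hc _).mul_const a)) (fun y => ?_) x
  refine componentHat_induction
    (P := fun a => γ.projHat F i (γ.toLHat F y * a) = γ.projHat F (i - j) (γ.toLHat F y) * a)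
    (isClosed_eq ((hc i).comp (continuous_const_mul _)) (continuous_const_mul _)) ?_ ha
  intro b hb
  rw [← map_mul, projHat_toLHat, projHat_toLHat, proj_mul_right hb, map_mul]

/-- An additive property of homogeneous elements holds for all elements. -/
theorem homogeneous_induction {P : γ.LHat F → Prop} (h0 : P 0)
    (hadd : ∀ x y, P x → P y → P (x + y)) (h : ∀ i, ∀ x ∈ γ.componentHat F i, P x)
    (x : γ.LHat F) : P x :=
  Submodule.iSup_induction (γ.componentHat F) (motive := P)
    (by rw [iSup_componentHat]; exact Submodule.mem_top) h h0 hadd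

/-! ### The ideals `I(W)` -/

variable {W : Set V}

theorem mem_idealI_iff {x : γ.LHat F} :
    x ∈ γ.idealI F W ↔ ∀ J ∈ γ.closedIdeals F W, x ∈ J :=
  Submodule.mem_sInf

theorem mul_mem_idealI_left (a : γ.LHat F) {x : γ.LHat F} (hx : x ∈ γ.idealI F W) :
    a * x ∈ γ.idealI F W :=
  mem_idealI_iff.2 fun J hJ => (hJ.2.1 a x (mem_idealI_iff.1 hx J hJ)).1

theorem mul_mem_idealI_right {x : γ.LHat F} (hx : x ∈ γ.idealI F W) (a : γ.LHat F) :
    x * a ∈ γ.idealI F W :=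
  mem_idealI_iff.2 fun J hJ => (hJ.2.1 a x (mem_idealI_iff.1 hx J hJ)).2

theorem vtxHat_mem_idealI {w : V} (hw : w ∈ W) : γ.vtxHat F w ∈ γ.idealI F W :=
  mem_idealI_iff.2 fun _ hJ => hJ.2.2 w hw

theorem isClosed_idealI : IsClosed (γ.idealI F W : Set (γ.LHat F)) := by
  have : (γ.idealI F W : Set (γ.LHat F)) = ⋂ J ∈ γ.closedIdeals F W, (J : Set (γ.LHat F)) := by
    ext x
    simp [mem_idealI_iff]
  rw [this]
  exact isClosed_biInter fun J hJ => hJ.1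

/-- Since the vertices are homogeneous, the elements all of whose homogeneous components lie
in `I(W)` are a closed ideal that contains `W`. -/
theorem projHat_mem_idealI (i : ℤ) {x : γ.LHat F} (hx : x ∈ γ.idealI F W) :
    γ.projHat F i x ∈ γ.idealI F W := by
  have hsmul (c : F) (x : γ.LHat F) (i : ℤ) : γ.projHat F i (c • x) = c • γ.projHat F i x := by
    have h1 : algebraMap F (γ.LHat F) c ∈ γ.componentHat F 0 := by
      rw [← (γ.toLHat F).commutes, Algebra.algebraMap_eq_smul_one]
      exact γ.toLHat_mem_componentHat F (Submodule.smul_mem _ _ (one_mem_component F))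
    rw [Algebra.smul_def, projHat_mul_left h1, sub_zero, Algebra.smul_def]
  let K : Submodule F (γ.LHat F) :=
    { carrier := {x | ∀ i, γ.projHat F i x ∈ γ.idealI F W}
      zero_mem' := fun i => by rw [map_zero]; exact zero_mem _
      add_mem' := fun ha hb i => by rw [map_add]; exact add_mem (ha i) (hb i)
      smul_mem' := fun c x hx i => by
        rw [hsmul, Algebra.smul_def]
        exact mul_mem_idealI_left _ (hx i) }
  refine mem_idealI_iff.1 hx K ⟨?_, fun a b hb => ⟨?_, ?_⟩, fun w hw i => ?_⟩ i
  · have : (K : Set (γ.LHat F)) = ⋂ i, γ.projHat F i ⁻¹' γ.idealI F W := by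
      ext x
      simp [K]
    rw [this]
    exact isClosed_iInter fun i => isClosed_idealI.preimage (γ.continuous_projHat F i)
  · refine homogeneous_induction (P := fun a => a * b ∈ K) ?_ ?_ ?_ a
    · rw [zero_mul]; exact K.zero_mem
    · intro x y hx hy; rw [add_mul]; exact K.add_mem hx hy
    · intro j x hx i
      rw [projHat_mul_left hx]
      exact mul_mem_idealI_left _ (hb _)
  · refine homogeneous_induction (P := fun a => b * a ∈ K) ?_ ?_ ?_ a
    · rw [mul_zero]; exact K.zero_mem
    · intro x y hx hy; rw [mul_add]; exact K.add_mem hx hy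
    · intro j x hx i
      rw [projHat_mul_right hx]
      exact mul_mem_idealI_right (hb _) _
  · have hw0 : γ.vtxHat F w ∈ γ.componentHat F 0 :=
      γ.toLHat_mem_componentHat F (vtx_mem_component F w)
    by_cases hi : (0 : ℤ) = i
    · subst hi
      rw [projHat_of_mem hw0]
      exact vtxHat_mem_idealI hw
    · rw [projHat_of_mem_ne hi hw0]
      exact zero_mem _

theorem isInternal_idealIComponent : DirectSum.IsInternal (γ.idealIComponent F W) := by
  rw [DirectSum.isInternal_submodule_iff_iSupIndep_and_iSup_eq_top]
  constructor
  · intro i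
    rw [Submodule.disjoint_def]
    intro x hx hx'
    have h0 : γ.projHat F i (x : γ.LHat F) = 0 := by
      rw [iSup_subtype'] at hx'
      refine Submodule.iSup_induction _
        (motive := fun x : γ.idealI F W => γ.projHat F i (x : γ.LHat F) = 0)
        hx' ?_ ?_ ?_
      · rintro ⟨j, hj⟩ y hy
        exact projHat_of_mem_ne hj hy
      · exact map_zero _
      · intro y z hy hz
        rw [NonUnitalSubalgebra.coe_add, map_add, hy, hz, add_zero]
    rw [projHat_of_mem hx] at h0
    exact Subtype.ext h0
  · rw [eq_top_iff]
    rintro ⟨x, hx⟩ -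
    have key : ∀ y : γ.LHat F, ∃ s : Finset ℤ, ∀ t, s ⊆ t → y = ∑ i ∈ t, γ.projHat F i y := by
      refine homogeneous_induction ⟨∅, by simp⟩ ?_ ?_
      · rintro x y ⟨s, hs⟩ ⟨t, ht⟩
        refine ⟨s ∪ t, fun u hu => ?_⟩
        simp only [map_add, Finset.sum_add_distrib]
        rw [← hs u (Finset.union_subset_left hu), ← ht u (Finset.union_subset_right hu)]
      · intro i x hx
        refine ⟨{i}, fun t ht => ?_⟩
        rw [Finset.sum_eq_single_of_mem i (by simpa using ht), projHat_of_mem hx]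
        intro j _ hj
        exact projHat_of_mem_ne hj.symm hx
    obtain ⟨s, hs⟩ := key x
    have : (⟨x, hx⟩ : γ.idealI F W) = ∑ i ∈ s, ⟨γ.projHat F i x, projHat_mem_idealI i hx⟩ := by
      ext1
      rw [AddSubmonoidClass.coe_finsetSum]
      exact hs s le_rfl
    rw [this]
    exact Submodule.sum_mem _ fun i _ => Submodule.mem_iSup_of_mem i (γ.projHat_mem F i x)

end Specialization

/-! ### Special prolongations and their idempotents -/

namespace Specialization

open Leavitt Topology Filter

variable (γ : G.Specialization)

open Classical in
/-- The end of the special edge with source `v`. A sink is its own successor. -/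
noncomputable def next (v : V) : V := if h : G.IsSink v then v else G.r (γ.toFun ⟨v, h⟩)

open Classical in
/-- The special path of length `n` with source `v`; it ends earlier if it meets a sink. -/
noncomputable def spec : ℕ → V → List E
  | 0, _ => []
  | n + 1, v => if h : G.IsSink v then [] else γ.toFun ⟨v, h⟩ :: spec n (γ.next v)

variable {γ}

theorem next_of_isSink {v : V} (h : G.IsSink v) : γ.next v = v := dif_pos h

theorem IsSpecial.eq_toFun {e : E} (he : γ.IsSpecial e) (h : ¬ G.IsSink (G.s e)) :
    γ.toFun ⟨G.s e, h⟩ = e :=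
  IsSpecial.eq ⟨_, rfl⟩ he (γ.s_toFun _)

theorem not_isSink_s (e : E) : ¬ G.IsSink (G.s e) := fun h => h e rfl

theorem IsSpecial.next {e : E} (he : γ.IsSpecial e) : γ.next (G.s e) = G.r e := by
  rw [Specialization.next, dif_neg (not_isSink_s e), he.eq_toFun]

theorem spec_of_isSink {v : V} (h : G.IsSink v) (n : ℕ) : γ.spec n v = [] := by
  cases n with
  | zero => rfl
  | succ n => exact dif_pos h

theorem IsSpecial.spec_succ {e : E} (he : γ.IsSpecial e) (n : ℕ) :
    γ.spec (n + 1) (G.s e) = e :: γ.spec n (G.r e) := by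
  rw [spec, dif_neg (not_isSink_s e), he.eq_toFun, he.next]

theorem exists_special {v : V} (h : ¬ G.IsSink v) : ∃ e, γ.IsSpecial e ∧ G.s e = v :=
  ⟨_, ⟨⟨v, h⟩, rfl⟩, γ.s_toFun _⟩

theorem iterate_next_of_isSink {v : V} (h : G.IsSink v) (n : ℕ) : γ.next^[n] v = v :=
  Function.iterate_fixed (next_of_isSink h) n

theorem isWalk_spec (n : ℕ) (v : V) : G.IsWalk v (γ.spec n v) (γ.next^[n] v) := by
  induction n generalizing v with
  | zero => rfl
  | succ n ih =>
    by_cases h : G.IsSink v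
    · rw [spec_of_isSink h, iterate_next_of_isSink h]
      rfl
    · obtain ⟨e, he, rfl⟩ := exists_special (γ := γ) h
      rw [he.spec_succ, Function.iterate_succ_apply, he.next]
      exact ⟨rfl, ih _⟩

/-- In a sink both sides are empty, so that no condition on the lengths is needed. -/
theorem spec_add (m n : ℕ) (v : V) :
    γ.spec (m + n) v = γ.spec m v ++ γ.spec n (γ.next^[m] v) := by
  induction m generalizing v with
  | zero => simp [spec]
  | succ m ih =>
    by_cases h : G.IsSink v
    · rw [iterate_next_of_isSink h]
      simp only [spec_of_isSink h, List.append_nil]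
    · obtain ⟨e, he, rfl⟩ := exists_special (γ := γ) h
      rw [Nat.add_right_comm, he.spec_succ, he.spec_succ, ih, Function.iterate_succ_apply, he.next, List.cons_append]

theorem length_spec {n : ℕ} {v : V} (h : ¬ G.IsSink (γ.next^[n] v)) :
    (γ.spec n v).length = n := by
  induction n generalizing v with
  | zero => rfl
  | succ n ih =>
    have hv : ¬ G.IsSink v := fun hv => h (by rwa [iterate_next_of_isSink hv])
    obtain ⟨e, he, rfl⟩ := exists_special (γ := γ) hv
    rw [Function.iterate_succ_apply, he.next] at h
    rw [he.spec_succ, List.length_cons, ih h]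

theorem eq_spec_of_forall {v t : V} {l : List E} (h : G.IsWalk v l t)
    (hl : ∀ e ∈ l, γ.IsSpecial e) : l = γ.spec l.length v ∧ t = γ.next^[l.length] v := by
  induction l generalizing v with
  | nil => exact ⟨rfl, Eq.symm h⟩
  | cons e l ih =>
    obtain ⟨rfl, h⟩ := h
    rw [List.forall_mem_cons] at hl
    obtain ⟨h1, h2⟩ := ih h hl.2
    rw [List.length_cons, hl.1.spec_succ, ← h1, Function.iterate_succ_apply, hl.1.next]
    exact ⟨rfl, h2⟩

theorem special_of_mem_spec (n : ℕ) (v : V) : ∀ e ∈ γ.spec n v, γ.IsSpecial e := by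
  induction n generalizing v with
  | zero => simp [spec]
  | succ n ih =>
    by_cases h : G.IsSink v
    · simp [spec_of_isSink h]
    · obtain ⟨e, he, rfl⟩ := exists_special (γ := γ) h
      rw [he.spec_succ, List.forall_mem_cons]
      exact ⟨he, ih _⟩

theorem eq_append_spec {v t t' : V} {l l' : List E} (h : G.IsWalk v l t) (h' : G.IsWalk v l' t')
    (hl : ∀ e ∈ l, γ.IsSpecial e) (hl' : ∀ e ∈ l', γ.IsSpecial e) {i : ℕ}
    (hi : l'.length = l.length + i) : l' = l ++ γ.spec i t ∧ t' = γ.next^[i] t := by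
  obtain ⟨h1, h2⟩ := eq_spec_of_forall h hl
  obtain ⟨h3, h4⟩ := eq_spec_of_forall h' hl'
  rw [hi, spec_add, ← h1, ← h2] at h3
  rw [hi, add_comm, Function.iterate_add_apply, ← h2] at h4
  exact ⟨h3, h4⟩

variable (γ) (F : Type*) [Field F] [Fintype V] [Fintype E]

/-- The idempotent `r r*`, where `r` is the special path of length `n` with source `v`. -/
noncomputable def specIdem (n : ℕ) (v : V) : G.Leavitt F :=
  real F v (γ.spec n v) * star F v (γ.spec n v)

theorem specIdem_zero (v : V) : γ.specIdem F 0 v = vtx F v := by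
  rw [specIdem, spec, real_nil, star_nil, vtx_mul_self]

theorem specIdem_of_isSink {v : V} (h : G.IsSink v) (n : ℕ) : γ.specIdem F n v = vtx F v := by
  rw [specIdem, spec_of_isSink h, real_nil, star_nil, vtx_mul_self]

theorem specIdem_succ {e : E} (he : γ.IsSpecial e) (n : ℕ) :
    γ.specIdem F (n + 1) (G.s e) = edge F e * γ.specIdem F n (G.r e) * ghost F e := by
  rw [specIdem, he.spec_succ, real_cons, star_cons, specIdem]
  simp only [mul_assoc]

theorem specIdem_add (m n : ℕ) (v : V) : γ.specIdem F (m + n) v =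
    real F v (γ.spec m v) * γ.specIdem F n (γ.next^[m] v) * star F v (γ.spec m v) := by
  rw [specIdem, spec_add, ← real_append F (isWalk_spec m v), ← star_append F (isWalk_spec m v),
    specIdem]
  simp only [mul_assoc]

theorem specIdem_mul_self (n : ℕ) (v : V) :
    γ.specIdem F n v * γ.specIdem F n v = γ.specIdem F n v := by
  have h := isWalk_spec (γ := γ) n v
  rw [specIdem, mul_assoc, ← mul_assoc (star F v _), star_mul_real_self h, vtx_mul_star F h]

theorem vtx_mul_specIdem (n : ℕ) (v : V) :
    vtx F v * γ.specIdem F n v = γ.specIdem F n v := by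
  rw [specIdem, ← mul_assoc, vtx_mul_real]

theorem specIdem_mul_vtx (n : ℕ) (v : V) :
    γ.specIdem F n v * vtx F v = γ.specIdem F n v := by
  rw [specIdem, mul_assoc, star_mul_vtx]

theorem specIdem_mul_edge {e : E} (he : ¬ γ.IsSpecial e) (n : ℕ) (v : V) :
    γ.specIdem F (n + 1) v * edge F e = 0 := by
  by_cases h : G.IsSink v
  · rw [specIdem_of_isSink γ F h]
    exact vtx_mul_edge_of_ne fun h' => h e h'.symm
  · obtain ⟨f, hf, rfl⟩ := exists_special (γ := γ) h
    rw [specIdem_succ γ F hf, mul_assoc, ghost_mul_edge F (by rintro rfl; exact he hf), mul_zero]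

theorem ghost_mul_specIdem {e : E} (he : ¬ γ.IsSpecial e) (n : ℕ) (v : V) :
    ghost F e * γ.specIdem F (n + 1) v = 0 := by
  by_cases h : G.IsSink v
  · rw [specIdem_of_isSink γ F h]
    exact ghost_mul_vtx_of_ne (h e)
  · obtain ⟨f, hf, rfl⟩ := exists_special (γ := γ) h
    rw [specIdem_succ γ F hf, ← mul_assoc, ← mul_assoc, ghost_mul_edge F (by rintro rfl; exact he hf),
      zero_mul, zero_mul]

theorem specIdem_mem_component (n : ℕ) (v : V) : γ.specIdem F n v ∈ component G F 0 :=
  Submodule.subset_span ⟨⟨v, _, _, isWalk_spec n v⟩, ⟨v, _, _, isWalk_spec n v⟩, rfl, by simp, rfl⟩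

/-- By the last of the defining relations, `w - e e*`, where `e` is the special edge with source
`w`, is the sum of the `f f*` for the other edges `f` with this source. The paths `q f` end with an
edge that is not special, so that the products `q f f* q*` are small if `q` is long. -/
theorem real_mul_vtx_sub_mul_star_mem {u w : V} {q : List E} (hq : G.IsWalk u q w) {k : ℝ}
    (hk : 0 ≤ k) (h : ¬ G.IsSink w → k ≤ 2 * q.length + 2) :
    real F u q * (vtx F w - γ.specIdem F 1 w) * star F u q ∈ γ.nbhd F k := by
  classical
  by_cases hw : G.IsSink w
  · rw [specIdem_of_isSink γ F hw]
    simp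
  obtain ⟨e, he, rfl⟩ := exists_special (γ := γ) hw
  have key : (vtx F (G.s e) - γ.specIdem F 1 (G.s e) : G.Leavitt F) =
      ∑ f ∈ ({f | G.s f = G.s e} : Finset E).erase e, edge F f * ghost F f := by
    rw [vtx_eq_sum hw, ← zero_add 1, specIdem_succ γ F he, specIdem_zero, edge_mul_vtx,
      sub_eq_iff_eq_add, Finset.sum_erase_add _ _ (by simp)]
  rw [key, Finset.mul_sum, Finset.sum_mul]
  refine Submodule.sum_mem _ fun f hf => ?_
  simp only [Finset.mem_erase, Finset.mem_filter, Finset.mem_univ, true_and] at hf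
  have hfs : ¬ γ.IsSpecial f := fun h => hf.1 (IsSpecial.eq h he hf.2)
  have hwalk : G.IsWalk u (q ++ [f]) (G.r f) := hq.append ⟨hf.2, rfl⟩
  rw [nbhd_eq_span γ F hk]
  refine Submodule.subset_span ⟨⟨u, _, _, hwalk⟩, ⟨u, _, _, hwalk⟩, rfl, ?_, ?_⟩
  · simp only [sd, γ.sdList_append_singleton_of_not hfs, Path.length, sub_self, abs_zero,
      List.length_append, List.length_singleton]
    push_cast
    linarith [h hw]
  · simp only [monomial]
    rw [← real_append F hq, ← star_append F hq, ← hf.2, real_singleton, star_singleton]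
    simp only [mul_assoc]

theorem specIdem_sub_succ_mem {u v : V} {p : List E} (hp : G.IsWalk u p v) {k : ℝ} (hk : 0 ≤ k)
    (n : ℕ) (h : k ≤ 2 * (p.length + n) + 2) :
    real F u p * (γ.specIdem F n v - γ.specIdem F (n + 1) v) * star F u p ∈ γ.nbhd F k := by
  have hn := isWalk_spec (γ := γ) n v
  have key : γ.specIdem F n v - γ.specIdem F (n + 1) v = real F v (γ.spec n v) *
      (vtx F (γ.next^[n] v) - γ.specIdem F 1 (γ.next^[n] v)) * star F v (γ.spec n v) := by
    rw [specIdem_add, mul_sub, sub_mul, real_mul_vtx F hn, specIdem]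
  rw [key, show real F u p * (real F v (γ.spec n v) *
      (vtx F (γ.next^[n] v) - γ.specIdem F 1 (γ.next^[n] v)) * star F v (γ.spec n v)) * star F u p =
      (real F u p * real F v (γ.spec n v)) *
      (vtx F (γ.next^[n] v) - γ.specIdem F 1 (γ.next^[n] v)) *
      (star F v (γ.spec n v) * star F u p) by simp only [mul_assoc],
    real_append F hp, star_append F hp]
  refine real_mul_vtx_sub_mul_star_mem γ F (hp.append hn) hk fun hs => ?_
  rw [List.length_append, length_spec hs]
  push_cast
  exact h

theorem exists_tendsto_specIdem (v : V) :
    ∃ x : γ.LHat F, Tendsto (fun n => γ.toLHat F (γ.specIdem F n v)) atTop (𝓝 x) := by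
  have : NonarchimedeanRing (γ.TopLeavitt F) := (γ.ringSubgroupsBasis F).nonarchimedean
  have hsub : Tendsto (fun n => γ.toLHat F (γ.specIdem F (n + 1) v) -
      γ.toLHat F (γ.specIdem F n v)) atTop (𝓝 0) := by
    refine (γ.hasBasis_nhds_zero F).tendsto_right_iff.2 fun k _ => ?_
    filter_upwards [eventually_ge_atTop k] with n hn
    rw [← map_sub, ← neg_sub, map_neg]
    refine neg_mem (γ.toLHat_mem_nbhdHat F ?_)
    have hn' : (k : ℝ) ≤ n := by exact_mod_cast hn
    have := γ.specIdem_sub_succ_mem F (u := v) (p := []) rfl (k := (k : ℝ) + 1) (by positivity) n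
      (by simp only [List.length_nil]; push_cast; linarith)
    rw [real_nil, star_nil, mul_sub, sub_mul] at this
    simpa only [vtx_mul_specIdem, specIdem_mul_vtx] using this
  have hsub' : Tendsto (fun n => γ.toLBar F (γ.specIdem F (n + 1) v) -
      γ.toLBar F (γ.specIdem F n v)) atTop (𝓝 0) := by
    have h := (continuous_subtype_val.tendsto (0 : γ.LHat F)).comp hsub
    exact h
  have hc : CauchySeq (fun n => γ.toLBar F (γ.specIdem F n v)) := 
    NonarchimedeanAddGroup.cauchySeq_of_tendsto_sub_nhds_zero hsub'
  obtain ⟨x, hx⟩ := cauchySeq_tendsto_of_complete hc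
  have hx0 : x ∈ γ.componentBar F 0 := by
    have hcl := Submodule.isClosed_topologicalClosure ((component G F 0).map (γ.toLBar F))
    exact hcl.mem_of_tendsto hx
      (Eventually.of_forall fun n => γ.toLBar_mem_componentBar F (γ.specIdem_mem_component F n v))
  exact ⟨⟨x, γ.componentBar_le F 0 hx0⟩, tendsto_subtype_rng.2 hx⟩

/-- The limit of the idempotents `r r*`, where `r` is the special path of length `n` with source
`v` and `n` tends to infinity. If `v` is a sink, it is the vertex `v`. -/
noncomputable def idem (v : V) : γ.LHat F := (γ.exists_tendsto_specIdem F v).choose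

theorem tendsto_idem (v : V) :
    Tendsto (fun n => γ.toLHat F (γ.specIdem F n v)) atTop (𝓝 (γ.idem F v)) :=
  (γ.exists_tendsto_specIdem F v).choose_spec

theorem idem_mul_self (v : V) : γ.idem F v * γ.idem F v = γ.idem F v := by
  refine tendsto_nhds_unique ((γ.tendsto_idem F v).mul (γ.tendsto_idem F v)) ?_
  simp only [← map_mul, specIdem_mul_self]
  exact γ.tendsto_idem F v

theorem vtx_mul_idem (v : V) : γ.toLHat F (vtx F v) * γ.idem F v = γ.idem F v := by
  refine tendsto_nhds_unique ((γ.tendsto_idem F v).const_mul _) ?_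
  simp only [← map_mul, vtx_mul_specIdem]
  exact γ.tendsto_idem F v

theorem idem_mul_vtx (v : V) : γ.idem F v * γ.toLHat F (vtx F v) = γ.idem F v := by
  refine tendsto_nhds_unique ((γ.tendsto_idem F v).mul_const _) ?_
  simp only [← map_mul, specIdem_mul_vtx]
  exact γ.tendsto_idem F v

theorem vtx_mul_idem_of_ne {v w : V} (h : v ≠ w) : γ.toLHat F (vtx F v) * γ.idem F w = 0 := by
  rw [← vtx_mul_idem, ← mul_assoc, ← map_mul, vtx_mul_vtx F h, map_zero, zero_mul]

theorem idem_mul_vtx_of_ne {v w : V} (h : v ≠ w) : γ.idem F v * γ.toLHat F (vtx F w) = 0 := by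
  rw [← idem_mul_vtx, mul_assoc, ← map_mul, vtx_mul_vtx F h, map_zero, mul_zero]

theorem edge_mul_idem_mul_ghost {e : E} (he : γ.IsSpecial e) :
    γ.toLHat F (edge F e) * γ.idem F (G.r e) * γ.toLHat F (ghost F e) = γ.idem F (G.s e) := by
  refine tendsto_nhds_unique (((γ.tendsto_idem F (G.r e)).const_mul _).mul_const _) ?_
  simp only [← map_mul, ← specIdem_succ γ F he]
  exact (tendsto_add_atTop_iff_nat 1).2 (γ.tendsto_idem F (G.s e))

theorem idem_mul_edge_of_not {e : E} (he : ¬ γ.IsSpecial e) (v : V) :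
    γ.idem F v * γ.toLHat F (edge F e) = 0 := by
  refine tendsto_nhds_unique
    (((tendsto_add_atTop_iff_nat 1).2 (γ.tendsto_idem F v)).mul_const _) ?_
  simp only [← map_mul, γ.specIdem_mul_edge F he, map_zero]
  exact tendsto_const_nhds

theorem ghost_mul_idem_of_not {e : E} (he : ¬ γ.IsSpecial e) (v : V) :
    γ.toLHat F (ghost F e) * γ.idem F v = 0 := by
  refine tendsto_nhds_unique
    (((tendsto_add_atTop_iff_nat 1).2 (γ.tendsto_idem F v)).const_mul _) ?_
  simp only [← map_mul, γ.ghost_mul_specIdem F he, map_zero]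
  exact tendsto_const_nhds

theorem idem_mul_edge {e : E} (he : γ.IsSpecial e) :
    γ.idem F (G.s e) * γ.toLHat F (edge F e) = γ.toLHat F (edge F e) * γ.idem F (G.r e) := by
  rw [← edge_mul_idem_mul_ghost γ F he, mul_assoc, ← map_mul, ghost_mul_edge_self, mul_assoc,
    idem_mul_vtx]

theorem ghost_mul_idem {e : E} (he : γ.IsSpecial e) :
    γ.toLHat F (ghost F e) * γ.idem F (G.s e) = γ.idem F (G.r e) * γ.toLHat F (ghost F e) := by
  rw [← edge_mul_idem_mul_ghost γ F he, ← mul_assoc, ← mul_assoc, ← map_mul, ghost_mul_edge_self,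
    vtx_mul_idem]

theorem ghost_mul_idem_mul_edge {e : E} (he : γ.IsSpecial e) :
    γ.toLHat F (ghost F e) * γ.idem F (G.s e) * γ.toLHat F (edge F e) = γ.idem F (G.r e) := by
  rw [ghost_mul_idem γ F he, mul_assoc, ← map_mul, ghost_mul_edge_self, idem_mul_vtx]

variable {F}

/-- The idempotent of `v` annihilates all paths except for the special ones with source `v`. -/
theorem idem_mul_real {u t : V} {l : List E} (hl : G.IsWalk u l t) (v : V)
    (h : γ.idem F v * γ.toLHat F (real F u l) ≠ 0) :
    v = u ∧ (∀ e ∈ l, γ.IsSpecial e) ∧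
      γ.idem F v * γ.toLHat F (real F u l) = γ.toLHat F (real F u l) * γ.idem F t := by
  induction l generalizing u v with
  | nil =>
    obtain rfl : u = t := hl
    rw [real_nil] at h ⊢
    obtain rfl : v = u := by
      by_contra hne
      exact h (γ.idem_mul_vtx_of_ne F hne)
    exact ⟨rfl, by simp, by rw [idem_mul_vtx, vtx_mul_idem]⟩
  | cons e l ih =>
    obtain ⟨rfl, hl⟩ := hl
    rw [real_cons, map_mul, ← mul_assoc] at h ⊢
    by_cases he : γ.IsSpecial e
    · by_cases hv : v = G.s e
      · subst hv
        rw [idem_mul_edge γ F he, mul_assoc] at h ⊢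
        obtain ⟨-, h1, h2⟩ := ih hl _ (right_ne_zero_of_mul h)
        exact ⟨rfl, List.forall_mem_cons.2 ⟨he, h1⟩, by rw [h2, mul_assoc]⟩
      · rw [← vtx_mul_edge, map_mul, ← mul_assoc, idem_mul_vtx_of_ne γ F hv] at h
        simp at h
    · rw [idem_mul_edge_of_not γ F he] at h
      simp at h

theorem star_mul_idem {u t : V} {l : List E} (hl : G.IsWalk u l t) (v : V)
    (h : γ.toLHat F (star F u l) * γ.idem F v ≠ 0) :
    v = u ∧ (∀ e ∈ l, γ.IsSpecial e) ∧
      γ.toLHat F (star F u l) * γ.idem F v = γ.idem F t * γ.toLHat F (star F u l) := by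
  induction l generalizing u v with
  | nil =>
    obtain rfl : u = t := hl
    rw [star_nil] at h ⊢
    obtain rfl : v = u := by
      by_contra hne
      exact h (γ.vtx_mul_idem_of_ne F (Ne.symm hne))
    exact ⟨rfl, by simp, by rw [idem_mul_vtx, vtx_mul_idem]⟩
  | cons e l ih =>
    obtain ⟨rfl, hl⟩ := hl
    rw [star_cons, map_mul, mul_assoc] at h ⊢
    by_cases he : γ.IsSpecial e
    · by_cases hv : v = G.s e
      · subst hv
        rw [ghost_mul_idem γ F he, ← mul_assoc] at h ⊢
        obtain ⟨-, h1, h2⟩ := ih hl _ (left_ne_zero_of_mul h)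
        exact ⟨rfl, List.forall_mem_cons.2 ⟨he, h1⟩, by rw [h2, mul_assoc]⟩
      · rw [← ghost_mul_vtx, map_mul, mul_assoc, vtx_mul_idem_of_ne γ F (Ne.symm hv)] at h
        simp at h
    · rw [ghost_mul_idem_of_not γ F he] at h
      simp at h

theorem real_mul_idem_mul_star {u t : V} {l : List E} (hl : G.IsWalk u l t)
    (hs : ∀ e ∈ l, γ.IsSpecial e) :
    γ.toLHat F (real F u l) * γ.idem F t * γ.toLHat F (star F u l) = γ.idem F u := by
  induction l generalizing u with
  | nil =>
    obtain rfl : u = t := hl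
    rw [real_nil, star_nil, vtx_mul_idem, idem_mul_vtx]
  | cons e l ih =>
    obtain ⟨rfl, hl⟩ := hl
    rw [List.forall_mem_cons] at hs
    rw [← edge_mul_idem_mul_ghost γ F hs.1, ← ih hl hs.2, real_cons, star_cons]
    simp only [map_mul, mul_assoc]

/-- The elements `p p*` of long paths are close to the elements `p e p*`, irrespective of `sd(p)`. -/
theorem real_mul_star_sub_mem {u t : V} {p : List E} (hp : G.IsWalk u p t) {k : ℝ} (hk : 0 ≤ k)
    (h : k ≤ 2 * p.length + 2) :
    γ.toLHat F (real F u p * star F u p) -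
      γ.toLHat F (real F u p) * γ.idem F t * γ.toLHat F (star F u p) ∈ γ.nbhdHat F k := by
  have key (n : ℕ) : real F u p * (vtx F t - γ.specIdem F n t) * star F u p ∈ γ.nbhd F k := by
    induction n with
    | zero => rw [specIdem_zero]; simp
    | succ n ih =>
      have := γ.specIdem_sub_succ_mem F hp hk n (h.trans (by
        have : (0 : ℝ) ≤ n := by positivity
        linarith))
      have h2 := add_mem ih this
      rwa [← add_mul, ← mul_add, sub_add_sub_cancel] at h2
  refine (γ.isClosed_nbhdHat F k).mem_of_tendsto (tendsto_const_nhds.sub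
    (((γ.tendsto_idem F t).const_mul _).mul_const _)) (Eventually.of_forall fun n => ?_)
  have := γ.toLHat_mem_nbhdHat F (key n)
  rw [mul_sub, sub_mul, real_mul_vtx F hp, map_sub, map_mul _ (real F u p * γ.specIdem F n t),
    map_mul _ (real F u p) (γ.specIdem F n t)] at this
  exact this

/-- A closed ideal that contains the idempotents of all vertices of a hereditary set contains its
vertices: `w` is the sum of the `p p*` for the paths `p` of length `N` with source `w` (and the
shorter ones that end in sinks), which are close to the elements `p e p*`, where `e` is the
idempotent of the target of `p`. -/
theorem vtxHat_mem_of_forall_idem {W : Set V} (hW : ∀ e, G.s e ∈ W → G.r e ∈ W)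
    {K : Submodule F (γ.LHat F)} (hK : IsClosed (K : Set (γ.LHat F)))
    (hmul : ∀ a, ∀ b ∈ K, a * b ∈ K ∧ b * a ∈ K) (h : ∀ v ∈ W, γ.idem F v ∈ K) {w : V}
    (hw : w ∈ W) : γ.vtxHat F w ∈ K := by
  classical
  have hcl : γ.vtxHat F w ∈ closure (K : Set (γ.LHat F)) := by
    rw [mem_closure_iff_sub_mem]
    intro k hk
    obtain ⟨N, hN⟩ := exists_nat_ge k
    have key : ∀ n, ∀ (p : List E) (t : V), G.IsWalk w p t → t ∈ W → p.length + n = N →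
        γ.toLHat F (real F w p * star F w p) ∈ K ⊔ γ.nbhdHat F k := by
      intro n
      induction n with
      | zero =>
        intro p t hp ht hl
        have hpl : (p.length : ℝ) = N := by exact_mod_cast hl
        have h1 := γ.real_mul_star_sub_mem (F := F) hp hk (by linarith)
        have h2 := (hmul (γ.toLHat F (star F w p)) _ (hmul (γ.toLHat F (real F w p)) _ (h t ht)).1).2
        have := add_mem (Submodule.mem_sup_left h2) (Submodule.mem_sup_right h1)
        rwa [add_sub_cancel] at this
      | succ n ih =>
        intro p t hp ht hl
        by_cases hs : G.IsSink t
        · have h2 := (hmul (γ.toLHat F (star F w p)) _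
            (hmul (γ.toLHat F (real F w p)) _ (h t ht)).1).2
          have h3 : γ.idem F t = γ.toLHat F (vtx F t) := by
            refine tendsto_nhds_unique (γ.tendsto_idem F t) ?_
            simp only [specIdem_of_isSink γ F hs]
            exact tendsto_const_nhds
          rw [h3, ← map_mul, real_mul_vtx F hp, ← map_mul] at h2
          exact Submodule.mem_sup_left h2
        · have hsum : (real F w p * star F w p : G.Leavitt F) =
              ∑ e : E with G.s e = t, real F w (p ++ [e]) * star F w (p ++ [e]) := by
            conv_lhs => rw [← real_mul_vtx F hp, vtx_eq_sum hs, Finset.mul_sum, Finset.sum_mul]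
            refine Finset.sum_congr rfl fun e he => ?_
            simp only [Finset.mem_filter, Finset.mem_univ, true_and] at he
            subst he
            rw [← real_append F hp, ← star_append F hp, real_singleton, star_singleton]
            simp only [mul_assoc]
          rw [hsum, map_sum]
          refine Submodule.sum_mem _ fun e he => ?_
          simp only [Finset.mem_filter, Finset.mem_univ, true_and] at he
          subst he
          exact ih (p ++ [e]) (G.r e) (hp.append ⟨rfl, rfl⟩) (hW e ht) (by simp; lia)
    have := key N [] w rfl hw (by simp)
    rw [real_nil, star_nil, vtx_mul_self] at this
    obtain ⟨y, hy, z, hz, hyz⟩ := Submodule.mem_sup.1 this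
    refine ⟨y, hy, ?_⟩
    rw [← toLHat_vtx, ← hyz, add_sub_cancel_left]
    exact hz
  rwa [hK.closure_eq] at hcl

end Specialization

/-! ### The corners cut out by the idempotents of the vertices -/

namespace Specialization

open Leavitt Topology Filter

variable (γ : G.Specialization) {F : Type*} [Field F] [Fintype V] [Fintype E]

/-- The topology is non-archimedean and `F` carries the discrete topology, so that lines are
discrete. -/
theorem isClosed_span_singleton (t : γ.LHat F) :
    IsClosed (Submodule.span F {t} : Set (γ.LHat F)) := by
  by_cases ht : t = 0
  · rw [ht, Submodule.span_zero_singleton]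
    exact isClosed_singleton
  obtain ⟨k, hk, htk⟩ : ∃ k : ℝ, 0 ≤ k ∧ t ∉ γ.nbhdHat F k := by
    by_contra! h
    exact ht (γ.eq_zero_of_forall_mem_nbhdHat F h)
  refine isClosed_of_closure_subset fun x hx => ?_
  rw [mem_closure_iff_sub_mem] at hx
  obtain ⟨y, hy, hxy⟩ := hx k hk
  suffices x - y = 0 by
    rw [sub_eq_zero.1 this]
    exact hy
  refine γ.eq_zero_of_forall_mem_nbhdHat F fun m hm => ?_
  obtain ⟨z, hz, hxz⟩ := hx (max k m) (le_max_of_le_left hk)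
  obtain ⟨a, ha⟩ := Submodule.mem_span_singleton.1 (Submodule.sub_mem _ hz hy)
  have h1 : z - y ∈ γ.nbhdHat F k := by
    have := Submodule.sub_mem _ hxy (γ.nbhdHat_anti F hk (le_max_left k m) hxz)
    rwa [sub_sub_sub_cancel_left] at this
  have ha0 : a = 0 := by
    by_contra ha0
    rw [← ha] at h1
    exact htk (((γ.nbhdHat F k).smul_mem_iff ha0).1 h1)
  rw [ha0, zero_smul, eq_comm, sub_eq_zero] at ha
  rw [← ha]
  exact γ.nbhdHat_anti F hm (le_max_right k m) hxz

theorem idem_mul_monomial_mul_idem {p q : G.Path} (hpq : p.tgt = q.tgt) {v w : V}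
    (h : γ.idem F v * γ.toLHat F (monomial F p q) * γ.idem F w ≠ 0) :
    (v = p.src ∧ w = q.src) ∧ ((∀ e ∈ p.edges, γ.IsSpecial e) ∧ ∀ e ∈ q.edges, γ.IsSpecial e) ∧
      γ.idem F v * γ.toLHat F (monomial F p q) * γ.idem F w =
        γ.toLHat F (real F p.src p.edges) * γ.idem F p.tgt *
          γ.toLHat F (star F q.src q.edges) := by
  rw [monomial, map_mul, ← mul_assoc, mul_assoc] at h ⊢
  obtain ⟨h1, h2, h3⟩ := γ.idem_mul_real p.isWalk v (left_ne_zero_of_mul h)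
  obtain ⟨h4, h5, h6⟩ := γ.star_mul_idem q.isWalk w (right_ne_zero_of_mul h)
  refine ⟨⟨h1, h4⟩, ⟨h2, h5⟩, ?_⟩
  rw [h3, h6, ← hpq, mul_assoc, ← mul_assoc (γ.idem F p.tgt), idem_mul_self, mul_assoc]

/-- Two pairs of special paths with the same sources and the same difference of lengths are
prolongations of each other, which does not change the corner element. -/
theorem idem_mul_monomial_mul_idem_eq {p q p' q' : G.Path} (hpq : p.tgt = q.tgt)
    (hpq' : p'.tgt = q'.tgt) (hdeg : (p.length : ℤ) - q.length = p'.length - q'.length) {v w : V}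
    (h : γ.idem F v * γ.toLHat F (monomial F p q) * γ.idem F w ≠ 0)
    (h' : γ.idem F v * γ.toLHat F (monomial F p' q') * γ.idem F w ≠ 0) :
    γ.idem F v * γ.toLHat F (monomial F p q) * γ.idem F w =
      γ.idem F v * γ.toLHat F (monomial F p' q') * γ.idem F w := by
  wlog hle : p.length ≤ p'.length generalizing p q p' q'
  · exact (this hpq' hpq hdeg.symm h' h (Nat.le_of_not_le hle)).symm
  obtain ⟨⟨hv, hw⟩, ⟨hp, hq⟩, heq⟩ := γ.idem_mul_monomial_mul_idem hpq h
  obtain ⟨⟨hv', hw'⟩, ⟨hp', hq'⟩, heq'⟩ := γ.idem_mul_monomial_mul_idem hpq' h'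
  rw [heq, heq', ← hv, ← hw, ← hv', ← hw']
  obtain ⟨i, hi⟩ := Nat.exists_eq_add_of_le hle
  have hi' : q'.length = q.length + i := by lia
  have wp : G.IsWalk v p.edges p.tgt := hv ▸ p.isWalk
  have wq : G.IsWalk w q.edges q.tgt := hw ▸ q.isWalk
  obtain ⟨hp1, ht⟩ := eq_append_spec wp (hv' ▸ p'.isWalk) hp hp' hi
  obtain ⟨hq1, -⟩ := eq_append_spec wq (hw' ▸ q'.isWalk) hq hq' hi'
  rw [hp1, hq1, ← real_append F wp, ← star_append F wq, ht, map_mul,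
    map_mul, ← hpq]
  have hs := γ.real_mul_idem_mul_star (F := F) (isWalk_spec i p.tgt) (special_of_mem_spec i p.tgt)
  rw [← hs]
  simp only [mul_assoc]

/-- A corner of a homogeneous component is at most one-dimensional. It is spanned by an element
`p e q*`, where `e` is the idempotent of a vertex, and thus this idempotent is obtained from every
nonzero element of the corner. -/
theorem exists_star_mul_mul_real_eq_smul_idem {j : ℤ} {c : γ.LHat F} (hc : c ∈ γ.componentHat F j)
    {v w : V} (h : γ.idem F v * c * γ.idem F w ≠ 0) :
    ∃ (p q : G.Path) (a : F), a ≠ 0 ∧ p.src = v ∧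
      γ.toLHat F (star F p.src p.edges) * (γ.idem F v * c * γ.idem F w) *
        γ.toLHat F (real F q.src q.edges) = a • γ.idem F p.tgt := by
  have hcont : Continuous fun c => γ.idem F v * c * γ.idem F w :=
    (continuous_const_mul _).mul_const _
  have hlin (t : γ.LHat F) (ht : ∀ p q : G.Path, p.tgt = q.tgt → (p.length : ℤ) - q.length = j →
      γ.idem F v * γ.toLHat F (monomial F p q) * γ.idem F w ∈ Submodule.span F {t}) :
      γ.idem F v * c * γ.idem F w ∈ Submodule.span F {t} := by
    refine componentHat_induction
      (P := fun c => γ.idem F v * c * γ.idem F w ∈ Submodule.span F {t})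
      ((γ.isClosed_span_singleton t).preimage hcont) (fun x hx => ?_) hc
    induction hx using Submodule.span_induction with
    | zero => rw [map_zero, mul_zero, zero_mul]; exact zero_mem _
    | add x y _ _ hx hy => rw [map_add, mul_add, add_mul]; exact add_mem hx hy
    | smul a x _ hx =>
      rw [map_smul, mul_smul_comm, smul_mul_assoc]
      exact Submodule.smul_mem _ a hx
    | mem x hx =>
      obtain ⟨p, q, hpq, hj, rfl⟩ := hx
      exact ht p q hpq hj
  obtain ⟨p, q, hpq, hj, hne⟩ : ∃ p q : G.Path, p.tgt = q.tgt ∧ (p.length : ℤ) - q.length = j ∧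
      γ.idem F v * γ.toLHat F (monomial F p q) * γ.idem F w ≠ 0 := by
    by_contra! h0
    refine h ?_
    have := hlin 0 fun p q hpq hj => by rw [h0 p q hpq hj]; exact zero_mem _
    rwa [Submodule.span_zero_singleton, Submodule.mem_bot] at this
  obtain ⟨a, ha⟩ := Submodule.mem_span_singleton.1
    (hlin (γ.idem F v * γ.toLHat F (monomial F p q) * γ.idem F w) fun p' q' hpq' hj' => by
      by_cases h' : γ.idem F v * γ.toLHat F (monomial F p' q') * γ.idem F w = 0
      · rw [h']; exact zero_mem _
      · rw [γ.idem_mul_monomial_mul_idem_eq hpq' hpq (hj'.trans hj.symm) h' hne]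
        exact Submodule.mem_span_singleton_self _)
  obtain ⟨⟨hv, hw⟩, -, heq⟩ := γ.idem_mul_monomial_mul_idem hpq hne
  refine ⟨p, q, a, ?_, hv.symm, ?_⟩
  · rintro rfl
    rw [zero_smul] at ha
    exact h ha.symm
  · have h1 := star_mul_real_self (F := F) p.isWalk
    have h2 := star_mul_real_self (F := F) q.isWalk
    rw [← ha, heq, mul_smul_comm, smul_mul_assoc]
    congr 1
    calc _ = γ.toLHat F (star F p.src p.edges * real F p.src p.edges) * γ.idem F p.tgt *
          γ.toLHat F (star F q.src q.edges * real F q.src q.edges) := by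
          simp only [map_mul, mul_assoc]
      _ = _ := by rw [h1, h2, ← hpq, vtx_mul_idem, idem_mul_vtx]

end Specialization

/-! ### Approximate units of the ideals generated by hereditary sets -/

theorem IsWalk.of_append {u w : V} {l m : List E} (h : G.IsWalk u (l ++ m) w) :
    ∃ v, G.IsWalk u l v ∧ G.IsWalk v m w := by
  induction l generalizing u with
  | nil => exact ⟨u, rfl, h⟩
  | cons e l ih =>
    obtain ⟨v, h1, h2⟩ := ih h.2
    exact ⟨v, ⟨h.1, h1⟩, h2⟩

theorem IsHereditary.r_mem {W : Set V} (hW : G.IsHereditary W) (e : E) (he : G.s e ∈ W) :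
    G.r e ∈ W :=
  hW.2 _ he _ ⟨⟨G.s e, [e], G.r e, rfl, rfl⟩, rfl, rfl⟩

theorem IsHereditary.mem_of_isWalk {W : Set V} (hW : G.IsHereditary W) {u v : V} {l : List E}
    (h : G.IsWalk u l v) (hu : u ∈ W) : v ∈ W :=
  hW.2 u hu v ⟨⟨u, l, v, h⟩, rfl, rfl⟩

/-- The sets of the frame are disjoint. -/
theorem eq_of_mem_frame {W W' : Set V} (hW : W ∈ G.frame) (hW' : W' ∈ G.frame) {v : V}
    (hv : v ∈ W) (hv' : v ∈ W') : W = W' := by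
  have h : G.IsHereditary (W ∩ W') :=
    ⟨⟨v, hv, hv'⟩, fun w hw u hu => ⟨hW.prop.2 w hw.1 u hu, hW'.prop.2 w hw.2 u hu⟩⟩
  exact (hW.le_of_le h Set.inter_subset_left |>.trans Set.inter_subset_right).antisymm
    (hW'.le_of_le h Set.inter_subset_right |>.trans Set.inter_subset_left)

namespace Leavitt

variable (F : Type*) [Field F] [Fintype V] [Fintype E] {W : Set V}

variable (G W) in
open Classical in
/-- The sum of `q q*` over the paths `q` of length at most `n` with source `v` which end in `W`
and have no other vertices in `W`. -/
noncomputable def exhaust : ℕ → V → G.Leavitt F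
  | 0, v => if v ∈ W then vtx F v else 0
  | n + 1, v => if v ∈ W then vtx F v else
      ∑ e : E with G.s e = v, edge F e * exhaust n (G.r e) * ghost F e

variable (G W) in
/-- The sum of `q q*` over the paths `q` of length at most `n` which end in `W` and have no other
vertices in `W`. -/
noncomputable def exhaustSum (n : ℕ) : G.Leavitt F := ∑ v : V, exhaust G F W n v

theorem exhaust_of_mem {v : V} (h : v ∈ W) (n : ℕ) : exhaust G F W n v = vtx F v := by
  cases n <;> simp [exhaust, h]

open Classical in
theorem exhaust_succ_of_notMem {v : V} (h : v ∉ W) (n : ℕ) : exhaust G F W (n + 1) v =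
    ∑ e : E with G.s e = v, edge F e * exhaust G F W n (G.r e) * ghost F e := by
  simp [exhaust, h]

theorem exhaust_zero_of_notMem {v : V} (h : v ∉ W) : exhaust G F W 0 v = 0 := by
  simp [exhaust, h]

theorem vtx_mul_exhaust (n : ℕ) (v : V) : vtx F v * exhaust G F W n v = exhaust G F W n v := by
  classical
  by_cases h : v ∈ W
  · rw [exhaust_of_mem F h, vtx_mul_self]
  cases n with
  | zero => rw [exhaust_zero_of_notMem F h, mul_zero]
  | succ n =>
    rw [exhaust_succ_of_notMem F h, Finset.mul_sum]
    refine Finset.sum_congr rfl fun e he => ?_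
    simp only [Finset.mem_filter, Finset.mem_univ, true_and] at he
    rw [← mul_assoc, ← mul_assoc, ← he, vtx_mul_edge]

theorem exhaust_mul_vtx (n : ℕ) (v : V) : exhaust G F W n v * vtx F v = exhaust G F W n v := by
  classical
  by_cases h : v ∈ W
  · rw [exhaust_of_mem F h, vtx_mul_self]
  cases n with
  | zero => rw [exhaust_zero_of_notMem F h, zero_mul]
  | succ n =>
    rw [exhaust_succ_of_notMem F h, Finset.sum_mul]
    refine Finset.sum_congr rfl fun e he => ?_
    simp only [Finset.mem_filter, Finset.mem_univ, true_and] at he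
    rw [mul_assoc, ← he, ghost_mul_vtx]

theorem exhaustSum_mul_vtx (n : ℕ) (v : V) : exhaustSum G F W n * vtx F v = exhaust G F W n v := by
  rw [exhaustSum, Finset.sum_mul, Finset.sum_eq_single_of_mem v (Finset.mem_univ v),
    exhaust_mul_vtx]
  intro u _ hu
  rw [← exhaust_mul_vtx, mul_assoc, vtx_mul_vtx F hu, mul_zero]

theorem vtx_mul_exhaustSum (n : ℕ) (v : V) : vtx F v * exhaustSum G F W n = exhaust G F W n v := by
  rw [exhaustSum, Finset.mul_sum, Finset.sum_eq_single_of_mem v (Finset.mem_univ v),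
    vtx_mul_exhaust]
  intro u _ hu
  rw [← vtx_mul_exhaust, ← mul_assoc, vtx_mul_vtx F hu.symm, zero_mul]

variable (hW : ∀ e, G.s e ∈ W → G.r e ∈ W)

include hW

theorem exhaust_succ_mul_edge (n : ℕ) (e : E) :
    exhaust G F W (n + 1) (G.s e) * edge F e = edge F e * exhaust G F W n (G.r e) := by
  classical
  by_cases h : G.s e ∈ W
  · rw [exhaust_of_mem F h, exhaust_of_mem F (hW e h), vtx_mul_edge, edge_mul_vtx]
  · rw [exhaust_succ_of_notMem F h, Finset.sum_mul, Finset.sum_eq_single_of_mem e (by simp),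
      mul_assoc, ghost_mul_edge_self, mul_assoc, exhaust_mul_vtx]
    intro f _ hf
    rw [mul_assoc, ghost_mul_edge F hf, mul_zero]

theorem ghost_mul_exhaust_succ (n : ℕ) (e : E) :
    ghost F e * exhaust G F W (n + 1) (G.s e) = exhaust G F W n (G.r e) * ghost F e := by
  classical
  by_cases h : G.s e ∈ W
  · rw [exhaust_of_mem F h, exhaust_of_mem F (hW e h), ghost_mul_vtx, vtx_mul_ghost]
  · rw [exhaust_succ_of_notMem F h, Finset.mul_sum, Finset.sum_eq_single_of_mem e (by simp),
      ← mul_assoc, ← mul_assoc, ghost_mul_edge_self, vtx_mul_exhaust]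
    intro f _ hf
    rw [← mul_assoc, ← mul_assoc, ghost_mul_edge F hf.symm, zero_mul, zero_mul]

theorem exhaustSum_succ_mul_edge (n : ℕ) (e : E) :
    exhaustSum G F W (n + 1) * edge F e = edge F e * exhaustSum G F W n := by
  rw [← vtx_mul_edge, ← mul_assoc, exhaustSum_mul_vtx, exhaust_succ_mul_edge F hW, vtx_mul_edge,
    ← edge_mul_vtx, mul_assoc, mul_assoc, vtx_mul_exhaustSum, vtx_mul_exhaust]

theorem ghost_mul_exhaustSum_succ (n : ℕ) (e : E) :
    ghost F e * exhaustSum G F W (n + 1) = exhaustSum G F W n * ghost F e := by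
  rw [← ghost_mul_vtx, mul_assoc, vtx_mul_exhaustSum, ghost_mul_exhaust_succ F hW, ghost_mul_vtx,
    ← vtx_mul_ghost, ← mul_assoc, ← mul_assoc, exhaustSum_mul_vtx, exhaust_mul_vtx]

/-- The number `m` is the truncated difference of `n` and the length of the path. -/
theorem exhaust_mul_real {u t : V} {l : List E} (hl : G.IsWalk u l t) (n : ℕ) :
    exhaust G F W n u * real F u l = 0 ∨
      ∃ m, exhaust G F W n u * real F u l = real F u l * exhaust G F W m t := by
  induction l generalizing u n with
  | nil =>
    obtain rfl : u = t := hl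
    exact Or.inr ⟨n, by rw [real_nil, exhaust_mul_vtx, vtx_mul_exhaust]⟩
  | cons e l ih =>
    obtain ⟨rfl, hl⟩ := hl
    rw [real_cons, ← mul_assoc]
    suffices ∃ m, exhaust G F W n (G.s e) * edge F e = 0 ∨
        exhaust G F W n (G.s e) * edge F e = edge F e * exhaust G F W m (G.r e) by
      obtain ⟨m, h | h⟩ := this
      · exact Or.inl (by rw [h, zero_mul])
      · rw [h, mul_assoc]
        rcases ih hl m with h' | ⟨m', h'⟩
        · exact Or.inl (by rw [h', mul_zero])
        · exact Or.inr ⟨m', by rw [h', mul_assoc]⟩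
    cases n with
    | zero =>
      refine ⟨0, ?_⟩
      by_cases h : G.s e ∈ W
      · right
        rw [exhaust_of_mem F h, exhaust_of_mem F (hW e h), vtx_mul_edge, edge_mul_vtx]
      · left
        rw [exhaust_zero_of_notMem F h, zero_mul]
    | succ n => exact ⟨n, Or.inr (exhaust_succ_mul_edge F hW n e)⟩

theorem star_mul_exhaust {u t : V} {l : List E} (hl : G.IsWalk u l t) (n : ℕ) :
    star F u l * exhaust G F W n u = 0 ∨
      ∃ m, star F u l * exhaust G F W n u = exhaust G F W m t * star F u l := by
  induction l generalizing u n with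
  | nil =>
    obtain rfl : u = t := hl
    exact Or.inr ⟨n, by rw [star_nil, exhaust_mul_vtx, vtx_mul_exhaust]⟩
  | cons e l ih =>
    obtain ⟨rfl, hl⟩ := hl
    rw [star_cons, mul_assoc]
    suffices ∃ m, ghost F e * exhaust G F W n (G.s e) = 0 ∨
        ghost F e * exhaust G F W n (G.s e) = exhaust G F W m (G.r e) * ghost F e by
      obtain ⟨m, h | h⟩ := this
      · exact Or.inl (by rw [h, mul_zero])
      · rw [h, ← mul_assoc]
        rcases ih hl m with h' | ⟨m', h'⟩
        · exact Or.inl (by rw [h', zero_mul])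
        · exact Or.inr ⟨m', by rw [h', mul_assoc]⟩
    cases n with
    | zero =>
      refine ⟨0, ?_⟩
      by_cases h : G.s e ∈ W
      · right
        rw [exhaust_of_mem F h, exhaust_of_mem F (hW e h), ghost_mul_vtx, vtx_mul_ghost]
      · left
        rw [exhaust_zero_of_notMem F h, mul_zero]
    | succ n => exact ⟨n, Or.inr (ghost_mul_exhaust_succ F hW n e)⟩

omit hW

variable (G W) in
/-- The elements which are fixed under multiplication from either side by almost all of the
idempotents `exhaustSum G F W n`. For a hereditary set `W`, they are an ideal that
contains `W`. -/
def exhausted : Submodule F (G.Leavitt F) where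
  carrier := {x | ∃ n₀, ∀ n, n₀ ≤ n → exhaustSum G F W n * x = x ∧ x * exhaustSum G F W n = x}
  zero_mem' := ⟨0, fun _ _ => ⟨mul_zero _, zero_mul _⟩⟩
  add_mem' := by
    rintro x y ⟨m, hm⟩ ⟨n, hn⟩
    refine ⟨max m n, fun k hk => ?_⟩
    rw [mul_add, add_mul, (hm k (by lia)).1, (hn k (by lia)).1, (hm k (by lia)).2,
      (hn k (by lia)).2]
    exact ⟨rfl, rfl⟩
  smul_mem' := by
    rintro c x ⟨m, hm⟩
    refine ⟨m, fun k hk => ?_⟩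
    rw [mul_smul_comm, smul_mul_assoc, (hm k hk).1, (hm k hk).2]
    exact ⟨rfl, rfl⟩

theorem vtx_mem_exhausted {w : V} (hw : w ∈ W) : vtx F w ∈ exhausted G F W :=
  ⟨0, fun n _ => by rw [exhaustSum_mul_vtx, vtx_mul_exhaustSum, exhaust_of_mem F hw]; exact ⟨rfl, rfl⟩⟩

include hW in
theorem mul_mem_exhausted (a : G.Leavitt F) :
    ∀ x ∈ exhausted G F W, a * x ∈ exhausted G F W ∧ x * a ∈ exhausted G F W := by
  let S : Subalgebra F (G.Leavitt F) :=
    { carrier := {a | ∀ x ∈ exhausted G F W, a * x ∈ exhausted G F W ∧ x * a ∈ exhausted G F W}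
      mul_mem' := by
        intro a b ha hb x hx
        rw [mul_assoc, ← mul_assoc x]
        exact ⟨(ha _ (hb x hx).1).1, (hb _ (ha x hx).2).2⟩
      add_mem' := by
        intro a b ha hb x hx
        rw [add_mul, mul_add]
        exact ⟨add_mem (ha x hx).1 (hb x hx).1, add_mem (ha x hx).2 (hb x hx).2⟩
      algebraMap_mem' := by
        intro c x hx
        rw [← Algebra.commutes, ← Algebra.smul_def]
        exact ⟨Submodule.smul_mem _ _ hx, Submodule.smul_mem _ _ hx⟩ }
  have hv (v : V) : vtx F v ∈ S := by
    rintro x ⟨n₀, h⟩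
    refine ⟨⟨n₀, fun n hn => ⟨?_, ?_⟩⟩, ⟨n₀, fun n hn => ⟨?_, ?_⟩⟩⟩
    · rw [← mul_assoc, exhaustSum_mul_vtx, ← vtx_mul_exhaustSum, mul_assoc, (h n hn).1]
    · rw [mul_assoc, (h n hn).2]
    · rw [← mul_assoc, (h n hn).1]
    · rw [mul_assoc, vtx_mul_exhaustSum, ← exhaustSum_mul_vtx, ← mul_assoc, (h n hn).2]
  have he (e : E) : edge F e ∈ S := by
    rintro x ⟨n₀, h⟩
    refine ⟨⟨n₀ + 1, fun n hn => ?_⟩, ⟨n₀ + 1, fun n hn => ?_⟩⟩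
    all_goals
      obtain ⟨n, rfl⟩ := Nat.exists_eq_add_of_le' (Nat.le_of_add_left_le hn)
    · rw [← mul_assoc, exhaustSum_succ_mul_edge F hW, mul_assoc, (h n (by lia)).1, mul_assoc,
        (h (n + 1) (by lia)).2]
      exact ⟨rfl, rfl⟩
    · rw [← mul_assoc, (h (n + 1) (by lia)).1, mul_assoc, ← exhaustSum_succ_mul_edge F hW,
        ← mul_assoc, (h (n + 1 + 1) (by lia)).2]
      exact ⟨rfl, rfl⟩
  have hg (e : E) : ghost F e ∈ S := by
    rintro x ⟨n₀, h⟩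
    refine ⟨⟨n₀ + 1, fun n hn => ?_⟩, ⟨n₀ + 1, fun n hn => ?_⟩⟩
    all_goals
      obtain ⟨n, rfl⟩ := Nat.exists_eq_add_of_le' (Nat.le_of_add_left_le hn)
    · rw [← mul_assoc, ← ghost_mul_exhaustSum_succ F hW, mul_assoc, (h (n + 1 + 1) (by lia)).1,
        mul_assoc, (h (n + 1) (by lia)).2]
      exact ⟨rfl, rfl⟩
    · rw [← mul_assoc, (h (n + 1) (by lia)).1, mul_assoc, ghost_mul_exhaustSum_succ F hW,
        ← mul_assoc, (h n (by lia)).2]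
      exact ⟨rfl, rfl⟩
  refine induction_alg F S (fun p q _ => S.mul_mem (S.mul_mem (hv _) ?_) (S.mul_mem ?_ (hv _))) a
  · refine list_prod_mem fun x hx => ?_
    obtain ⟨e, -, rfl⟩ := List.mem_map.1 hx
    exact he e
  · refine list_prod_mem fun x hx => ?_
    obtain ⟨e, -, rfl⟩ := List.mem_map.1 hx
    exact hg e

end Leavitt

namespace Specialization

open Leavitt Topology Filter

variable {γ : G.Specialization} {W : Set V}

/-- The finiteness condition for regular specializations bounds the final special segments of
the paths that enter the set `W` with their last edge. -/
theorem IsRegular.exists_sdList_le (hγ : γ.IsRegular) (hW : W ∈ G.frame) :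
    ∃ C : ℕ, ∀ (x : List E) (u w : V), G.IsWalk u x w → (∀ e ∈ x, G.s e ∉ W) → w ∈ W →
      γ.sdList x ≤ C + 1 := by
  obtain ⟨C, hC⟩ := (hγ.finite.image Path.length).bddAbove
  refine ⟨C, fun x u w hx hs hw => ?_⟩
  obtain ⟨x₁, x₂, rfl, hlen, hspec⟩ := γ.exists_eq_append x
  rw [← hlen]
  obtain ⟨v, -, hv⟩ := hx.of_append
  rcases List.eq_nil_or_concat x₂ with rfl | ⟨y, f, rfl⟩
  · simp
  rw [List.concat_eq_append] at *
  rw [List.length_append, List.length_singleton, add_le_add_iff_right]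
  by_cases hy : y = []
  · simp [hy]
  -- a vertex from which `w` can be reached lies in no other set of the frame than `W`
  have hout : ∀ e ∈ y ++ [f], G.s e ∉ ⋃₀ G.frame := by
    rintro e he ⟨W', hW', heW'⟩
    obtain ⟨a, b, hab⟩ := List.append_of_mem he
    rw [hab] at hv
    obtain ⟨v', -, hv'⟩ := hv.of_append
    have h1 : w ∈ W' := IsHereditary.mem_of_isWalk hW'.prop hv' (hv'.1 ▸ heW')
    rw [eq_of_mem_frame hW' hW h1 hw] at heW'
    exact hs e (List.mem_append_right _ he) heW'
  have hsucc : ∀ e ∈ y, ∃ e' ∈ y ++ [f], G.s e' = G.r e := by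
    intro e he
    obtain ⟨a, b, rfl⟩ := List.append_of_mem he
    rw [List.append_assoc, List.cons_append] at hv
    obtain ⟨v', -, -, hv'⟩ := hv.of_append
    cases b with
    | nil => exact ⟨f, by simp, hv'.1⟩
    | cons c b => exact ⟨c, by simp, hv'.1⟩
  obtain ⟨t, ht, -⟩ := hv.of_append
  refine hC ⟨⟨v, y, t, ht⟩, ⟨⟨hy, fun e he => hspec e (by simp [he])⟩, fun e he => ?_⟩, rfl⟩
  obtain ⟨e', he', hr⟩ := hsucc e he
  exact ⟨hout e (by simp [he]), hr ▸ hout e' he'⟩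

variable (F : Type*) [Field F] [Fintype V] [Fintype E]

/-- By the recursion for `exhaust`, the product is a sum of monomials `(p x) (q x)*`, where `x`
meets `W` only in its target. The prolongation by `x` preserves the difference of the lengths
and adds at most `C + 1` to each of `sd(p)` and `sd(q)`, whence the factor `2 * C + 3`. -/
theorem real_mul_exhaust_mul_star_mem {C : ℕ}
    (hC : ∀ (x : List E) (u w : V), G.IsWalk u x w → (∀ e ∈ x, G.s e ∉ W) → w ∈ W →
      γ.sdList x ≤ C + 1) {k : ℝ} (hk : 0 ≤ k) {p q : G.Path} (hpq : p.tgt = q.tgt)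
    (h : k * (2 * C + 3) * ((γ.sd p : ℝ) + γ.sd q + |(p.length : ℝ) - q.length| + 1) ≤
      (p.length : ℝ) + q.length) (m : ℕ) :
    real F p.src p.edges * exhaust G F W m p.tgt * star F q.src q.edges ∈ γ.nbhd F k := by
  classical
  have hbase (x : List E) (u : V) (hx : G.IsWalk p.tgt x u) (hs : ∀ e ∈ x, G.s e ∉ W)
      (hu : u ∈ W) (m : ℕ) : real F p.src (p.edges ++ x) * exhaust G F W m u *
        star F q.src (q.edges ++ x) ∈ γ.nbhd F k := by
    have h1 := p.isWalk.append hx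
    have h2 := q.isWalk.append (hpq ▸ hx)
    rw [exhaust_of_mem F hu, real_mul_vtx F h1, nbhd_eq_span γ F hk]
    refine Submodule.subset_span ⟨⟨_, _, _, h1⟩, ⟨_, _, _, h2⟩, rfl, ?_, rfl⟩
    have s0 := hC x _ _ hx hs hu
    have s1 : (γ.sdList (p.edges ++ x) : ℝ) ≤ γ.sd p + (C + 1) := by
      exact_mod_cast (γ.sdList_append_le p.edges x).trans (Nat.add_le_add_left s0 _)
    have s2 : (γ.sdList (q.edges ++ x) : ℝ) ≤ γ.sd q + (C + 1) := by
      exact_mod_cast (γ.sdList_append_le q.edges x).trans (Nat.add_le_add_left s0 _)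
    simp only [sd, Path.length, List.length_append] at h s1 s2 ⊢
    push_cast
    rw [add_sub_add_right_eq_sub]
    set d := |(p.edges.length : ℝ) - q.edges.length| with hd
    have hd0 : 0 ≤ d := abs_nonneg _
    have hp0 : (0 : ℝ) ≤ γ.sdList p.edges := by positivity
    have hq0 : (0 : ℝ) ≤ γ.sdList q.edges := by positivity
    have hx0 : (0 : ℝ) ≤ x.length := by positivity
    have hC0 : (0 : ℝ) ≤ C := by positivity
    have hle : (γ.sdList (p.edges ++ x) : ℝ) + γ.sdList (q.edges ++ x) + d + 1 ≤
        (2 * C + 3) * ((γ.sdList p.edges : ℝ) + γ.sdList q.edges + d + 1) := by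
      have : 0 ≤ (2 * C + 2) * ((γ.sdList p.edges : ℝ) + γ.sdList q.edges + d) := by positivity
      linarith
    have := mul_le_mul_of_nonneg_left hle hk
    rw [← mul_assoc] at this
    linarith
  have key : ∀ m (x : List E) (u : V), G.IsWalk p.tgt x u → (∀ e ∈ x, G.s e ∉ W) →
      real F p.src (p.edges ++ x) * exhaust G F W m u * star F q.src (q.edges ++ x) ∈
        γ.nbhd F k := by
    intro m
    induction m with
    | zero =>
      intro x u hx hs
      by_cases hu : u ∈ W
      · exact hbase x u hx hs hu 0
      · rw [exhaust_zero_of_notMem F hu]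
        simp
    | succ m ih =>
      intro x u hx hs
      by_cases hu : u ∈ W
      · exact hbase x u hx hs hu (m + 1)
      · rw [exhaust_succ_of_notMem F hu, Finset.mul_sum, Finset.sum_mul]
        refine Submodule.sum_mem _ fun e he => ?_
        simp only [Finset.mem_filter, Finset.mem_univ, true_and] at he
        subst he
        have h1 := p.isWalk.append hx
        have h2 := q.isWalk.append (hpq ▸ hx)
        have := ih (x ++ [e]) (G.r e) (hx.append ⟨rfl, rfl⟩) (by
          intro f hf
          rcases List.mem_append.1 hf with hf | hf
          · exact hs f hf
          · rw [List.mem_singleton.1 hf]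
            exact hu)
        rw [← List.append_assoc, ← List.append_assoc, ← real_append F h1, ← star_append F h2,
          real_singleton, star_singleton] at this
        simpa only [mul_assoc] using this
  have := key m [] p.tgt rfl (by simp)
  rwa [List.append_nil, List.append_nil] at this

/-- For a regular specialization, multiplication by the idempotents `exhaustSum G F W n` is
equicontinuous in `n`. -/
theorem IsRegular.exists_exhaustSum_mul_mem (hγ : γ.IsRegular) (hW : W ∈ G.frame) :
    ∃ D : ℝ, 1 ≤ D ∧ ∀ k : ℝ, 0 ≤ k → ∀ n, ∀ x ∈ γ.nbhdHat F (k * D),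
      γ.toLHat F (exhaustSum G F W n) * x ∈ γ.nbhdHat F k ∧
        x * γ.toLHat F (exhaustSum G F W n) ∈ γ.nbhdHat F k := by
  obtain ⟨C, hC⟩ := hγ.exists_sdList_le hW
  have hr := hW.prop.r_mem
  have hC0 : (0 : ℝ) ≤ C := by positivity
  have key (k : ℝ) (hk : 0 ≤ k) (n : ℕ) : ∀ x ∈ γ.nbhd F (k * (2 * C + 3)),
      exhaustSum G F W n * x ∈ γ.nbhd F k ∧ x * exhaustSum G F W n ∈ γ.nbhd F k := by
    intro x hx
    rw [nbhd_eq_span γ F (by positivity)] at hx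
    induction hx using Submodule.span_induction with
    | zero => simp
    | add x y _ _ hx hy =>
      rw [mul_add, add_mul]
      exact ⟨add_mem hx.1 hy.1, add_mem hx.2 hy.2⟩
    | smul c x _ hx =>
      rw [mul_smul_comm, smul_mul_assoc]
      exact ⟨Submodule.smul_mem _ _ hx.1, Submodule.smul_mem _ _ hx.2⟩
    | mem x hx =>
      obtain ⟨p, q, hpq, h, rfl⟩ := hx
      have hmem := real_mul_exhaust_mul_star_mem F hC hk hpq h
      constructor
      · rw [monomial, ← vtx_mul_real, ← mul_assoc, ← mul_assoc, exhaustSum_mul_vtx]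
        rcases exhaust_mul_real F hr p.isWalk n with h0 | ⟨m, hm⟩
        · rw [h0, zero_mul]; exact zero_mem _
        · rw [hm]; exact hmem m
      · rw [monomial, ← star_mul_vtx, mul_assoc, mul_assoc, vtx_mul_exhaustSum]
        rcases star_mul_exhaust F hr q.isWalk n with h0 | ⟨m, hm⟩
        · rw [h0, mul_zero]; exact zero_mem _
        · rw [hm, ← mul_assoc, ← hpq]; exact hmem m
  refine ⟨2 * C + 3, by linarith, fun k hk n x hx => ?_⟩
  rw [mem_nbhdHat_iff] at hx
  constructor
  · refine closure_minimal (t := {x | γ.toLHat F (exhaustSum G F W n) * x ∈ γ.nbhdHat F k}) ?_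
      ((γ.isClosed_nbhdHat F k).preimage (continuous_const_mul _)) hx
    rintro _ ⟨y, hy, rfl⟩
    rw [Set.mem_ofPred_eq, ← map_mul]
    exact γ.toLHat_mem_nbhdHat F (key k hk n y hy).1
  · refine closure_minimal (t := {x | x * γ.toLHat F (exhaustSum G F W n) ∈ γ.nbhdHat F k}) ?_
      ((γ.isClosed_nbhdHat F k).preimage (continuous_mul_const _)) hx
    rintro _ ⟨y, hy, rfl⟩
    rw [Set.mem_ofPred_eq, ← map_mul]
    exact γ.toLHat_mem_nbhdHat F (key k hk n y hy).2

variable {F}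

theorem mem_closure_exhausted (hW : ∀ e, G.s e ∈ W → G.r e ∈ W) {x : γ.LHat F}
    (hx : x ∈ γ.idealI F W) : x ∈ closure (γ.toLHat F '' exhausted G F W) := by
  let K : Submodule F (γ.LHat F) :=
    { carrier := closure (γ.toLHat F '' exhausted G F W)
      zero_mem' := subset_closure ⟨0, zero_mem _, map_zero _⟩
      add_mem' := by
        intro a b ha hb
        refine map_mem_closure₂ continuous_add ha hb ?_
        rintro _ ⟨y, hy, rfl⟩ _ ⟨z, hz, rfl⟩
        exact ⟨y + z, add_mem hy hz, map_add _ _ _⟩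
      smul_mem' := by
        intro c a ha
        rw [Algebra.smul_def]
        refine map_mem_closure (continuous_const_mul _) ha ?_
        rintro _ ⟨y, hy, rfl⟩
        exact ⟨c • y, Submodule.smul_mem _ _ hy, by rw [map_smul, Algebra.smul_def]⟩ }
  refine mem_idealI_iff.1 hx K ⟨isClosed_closure, fun a b hb => ⟨?_, ?_⟩, fun w hw => ?_⟩
  · refine map_mem_closure₂ continuous_mul (γ.mem_closure_range_toLHat F a) hb ?_
    rintro _ ⟨y, rfl⟩ _ ⟨z, hz, rfl⟩
    exact ⟨y * z, (mul_mem_exhausted F hW y z hz).1, map_mul _ _ _⟩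
  · refine map_mem_closure₂ continuous_mul hb (γ.mem_closure_range_toLHat F a) ?_
    rintro _ ⟨z, hz, rfl⟩ _ ⟨y, rfl⟩
    exact ⟨z * y, (mul_mem_exhausted F hW y z hz).2, map_mul _ _ _⟩
  · exact subset_closure ⟨_, vtx_mem_exhausted F hw, rfl⟩

theorem toLHat_exhaustSum_mem_idealI (n : ℕ) :
    γ.toLHat F (exhaustSum G F W n) ∈ γ.idealI F W := by
  classical
  have key (v : V) : γ.toLHat F (exhaust G F W n v) ∈ γ.idealI F W := by
    induction n generalizing v with
    | zero =>
      by_cases h : v ∈ W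
      · rw [exhaust_of_mem F h]; exact vtxHat_mem_idealI h
      · rw [exhaust_zero_of_notMem F h, map_zero]; exact zero_mem _
    | succ n ih =>
      by_cases h : v ∈ W
      · rw [exhaust_of_mem F h]; exact vtxHat_mem_idealI h
      · rw [exhaust_succ_of_notMem F h, map_sum]
        refine sum_mem fun e _ => ?_
        rw [map_mul, map_mul]
        exact mul_mem_idealI_right (mul_mem_idealI_left _ (ih _)) _
  rw [exhaustSum, map_sum]
  exact sum_mem fun v _ => key v

/-- The ideal `I(W)` has no elements which are annihilated by it from both sides, since
`p x p → x` for `x ∈ I(W)`, where `p` runs through the idempotents `exhaustSum G F W n` of `I(W)`. -/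
theorem IsRegular.eq_zero_of_forall_mul_mul_eq_zero (hγ : γ.IsRegular) (hW : W ∈ G.frame)
    {a : γ.LHat F} (ha : a ∈ γ.idealI F W)
    (h : ∀ c ∈ γ.idealI F W, ∀ d ∈ γ.idealI F W, c * a * d = 0) : a = 0 := by
  obtain ⟨D, hD, hmul⟩ := hγ.exists_exhaustSum_mul_mem F hW
  refine γ.eq_zero_of_forall_mem_nbhdHat F fun k hk => ?_
  have hkD : k ≤ k * D := le_mul_of_one_le_right hk hD
  have hkDD : k * D ≤ k * D * D := le_mul_of_one_le_right (hk.trans hkD) hD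
  obtain ⟨_, ⟨x, ⟨n, hn⟩, rfl⟩, hx⟩ := (γ.mem_closure_iff_sub_mem F).1
    (mem_closure_exhausted hW.prop.r_mem ha) (k * D * D) (hk.trans (hkD.trans hkDD))
  have h1 := (hmul k hk n _ (hmul (k * D) (hk.trans hkD) n _ hx).1).2
  have hP := toLHat_exhaustSum_mem_idealI (γ := γ) (F := F) (W := W) n
  rw [mul_sub, sub_mul, h _ hP _ hP, ← map_mul, ← map_mul, (hn n le_rfl).1, (hn n le_rfl).2,
    zero_sub, neg_mem_iff] at h1
  have := add_mem (γ.nbhdHat_anti F hk (hkD.trans hkDD) hx) h1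
  rwa [sub_add_cancel] at this

theorem idem_mem_idealI {v : V} (hv : v ∈ W) : γ.idem F v ∈ γ.idealI F W := by
  rw [← vtx_mul_idem]
  exact mul_mem_idealI_right (vtxHat_mem_idealI hv) _

/-- A nonzero element of `I(W)` is not annihilated by the idempotents of the vertices in `W`, as
the closed ideal generated by these is `I(W)`. -/
theorem IsRegular.exists_idem_mul_ne_zero (hγ : γ.IsRegular) (hW : W ∈ G.frame)
    {a : γ.LHat F} (ha : a ∈ γ.idealI F W) (ha0 : a ≠ 0) :
    ∃ v ∈ W, ∃ w ∈ W, ∃ i j, ∃ x ∈ γ.componentHat F i, ∃ y ∈ γ.componentHat F j,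
      γ.idem F v * (x * a * y) * γ.idem F w ≠ 0 := by
  by_contra! h0
  have h1 : ∀ v ∈ W, ∀ w ∈ W, ∀ x y, γ.idem F v * (x * a * y) * γ.idem F w = 0 := by
    intro v hv w hw x y
    refine homogeneous_induction (P := fun x => γ.idem F v * (x * a * y) * γ.idem F w = 0) ?_ ?_
      (fun i x hx => ?_) x
    · simp
    · intro x x' hx hx'
      simp only [add_mul, mul_add, hx, hx', add_zero]
    · refine homogeneous_induction (P := fun y => γ.idem F v * (x * a * y) * γ.idem F w = 0) ?_ ?_
        (fun j y hy => h0 v hv w hw i j x hx y hy) y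
      · simp
      · intro y y' hy hy'
        simp only [add_mul, mul_add, hy, hy', add_zero]
  refine ha0 (hγ.eq_zero_of_forall_mul_mul_eq_zero hW ha ?_)
  have h2 : ∀ d ∈ γ.idealI F W, ∀ v ∈ W, ∀ x y, γ.idem F v * (x * a * y) * d = 0 := by
    let K : Submodule F (γ.LHat F) :=
      { carrier := {d | ∀ v ∈ W, ∀ x y, γ.idem F v * (x * a * y) * d = 0}
        zero_mem' := by simp
        add_mem' := fun hb hc v hv x y => by rw [mul_add, hb v hv, hc v hv, add_zero]
        smul_mem' := fun c b hb v hv x y => by rw [mul_smul_comm, hb v hv, smul_zero] }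
    have hK : IsClosed (K : Set (γ.LHat F)) := by
      simp only [K, Submodule.coe_set_mk, AddSubmonoid.coe_set_mk, AddSubsemigroup.coe_set_mk,
        Set.ofPred_forall]
      exact isClosed_iInter fun v => isClosed_iInter fun _ => isClosed_iInter fun x =>
        isClosed_iInter fun y => isClosed_eq (continuous_const_mul _) continuous_const
    have hmul (b : γ.LHat F) : ∀ d ∈ K, b * d ∈ K ∧ d * b ∈ K := by
      refine fun d hd => ⟨fun v hv x y => ?_, fun v hv x y => ?_⟩
      · have := hd v hv x (y * b)
        simpa only [mul_assoc] using this
      · rw [← mul_assoc, hd v hv, zero_mul]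
    exact fun d hd => mem_idealI_iff.1 hd K ⟨hK, hmul, fun w hw =>
      γ.vtxHat_mem_of_forall_idem hW.prop.r_mem hK hmul (fun v hv u hu => h1 u hu v hv) hw⟩
  have h3 : ∀ c ∈ γ.idealI F W, ∀ d ∈ γ.idealI F W, ∀ x y, c * (x * a * y) * d = 0 := by
    let K : Submodule F (γ.LHat F) :=
      { carrier := {c | ∀ d ∈ γ.idealI F W, ∀ x y, c * (x * a * y) * d = 0}
        zero_mem' := by simp
        add_mem' := fun hb hc d hd x y => by rw [add_mul, add_mul, hb d hd, hc d hd, add_zero]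
        smul_mem' := fun c b hb d hd x y => by
          rw [smul_mul_assoc, smul_mul_assoc, hb d hd, smul_zero] }
    have hK : IsClosed (K : Set (γ.LHat F)) := by
      simp only [K, Submodule.coe_set_mk, AddSubmonoid.coe_set_mk, AddSubsemigroup.coe_set_mk,
        Set.ofPred_forall]
      exact isClosed_iInter fun d => isClosed_iInter fun _ => isClosed_iInter fun x =>
        isClosed_iInter fun y =>
          isClosed_eq ((continuous_mul_const _).mul_const _) continuous_const
    have hmul (b : γ.LHat F) : ∀ c ∈ K, b * c ∈ K ∧ c * b ∈ K := by
      refine fun c hc => ⟨fun d hd x y => ?_, fun d hd x y => ?_⟩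
      · rw [mul_assoc b, mul_assoc b, hc d hd, mul_zero]
      · have := hc d hd (b * x) y
        simpa only [mul_assoc] using this
    exact fun c hc => mem_idealI_iff.1 hc K ⟨hK, hmul, fun w hw =>
      γ.vtxHat_mem_of_forall_idem hW.prop.r_mem hK hmul (fun v hv d hd => h2 d hd v hv) hw⟩
  intro c hc d hd
  have := h3 c hc d hd 1 1
  rwa [one_mul, mul_one] at this

end Specialization

/-! ### Simplicity -/

namespace Specialization

open Leavitt Topology Filter

variable {γ : G.Specialization} {W : Set V} {F : Type*} [Field F] [Fintype V] [Fintype E]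

omit [Fintype V] [Fintype E] in
/-- A property that is transported along special edges in both directions holds for all vertices
of a set of the frame if it holds for one of them. -/
theorem IsRegular.connected_induction (hγ : γ.IsRegular) (hW : W ∈ G.frame) {P : V → Prop}
    (hP : ∀ e, γ.IsSpecial e → (P (G.s e) ↔ P (G.r e))) {u v : V} (hu : u ∈ W) (hv : v ∈ W)
    (h : P u) : P v := by
  obtain ⟨p⟩ := (hγ.connected W hW).preconnected ⟨u, hu⟩ ⟨v, hv⟩
  have key : ∀ {a b : W}, (γ.undirected W).Walk a b → P a → P b := by
    intro a b p
    induction p with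
    | nil => exact id
    | cons hadj _ ih =>
      refine fun h => ih ?_
      rw [undirected, SimpleGraph.fromRel_adj] at hadj
      rcases hadj.2 with ⟨e, he, h1, h2⟩ | ⟨e, he, h1, h2⟩
      · rw [← h2, ← hP e he, h1]
        exact h
      · rw [← h1, hP e he, h2]
        exact h
  exact key p h

/-- A nonzero homogeneous element `a` of a closed ideal `J` of `I(W)` yields, by multiplication
from both sides, a multiple of the idempotent of some vertex in `W`. Then `J` contains the
idempotents of all vertices in `W`, so that it is `I(W)`. -/
theorem IsRegular.idealI_le_of_mem (hγ : γ.IsRegular) (hW : W ∈ G.frame)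
    {J : Submodule F (γ.LHat F)} (hcl : IsClosed (J : Set (γ.LHat F)))
    (hJ : ∀ x ∈ J, x ∈ γ.idealI F W)
    (hmul : ∀ a ∈ γ.idealI F W, ∀ b ∈ J, a * b ∈ J ∧ b * a ∈ J)
    {i : ℤ} {a : γ.LHat F} (haJ : a ∈ J) (hai : a ∈ γ.componentHat F i) (ha : a ≠ 0) :
    ∀ x ∈ γ.idealI F W, x ∈ J := by
  have hW' := hW.prop.r_mem
  -- idempotents of `J` generate ideals of the whole algebra that are contained in `J`
  have hsand {v : V} (hv : γ.idem F v ∈ J) (x y : γ.LHat F) : x * γ.idem F v * y ∈ J := by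
    have hvI := hJ _ hv
    have := (hmul _ (mul_mem_idealI_right hvI y) _
      (hmul _ (mul_mem_idealI_left x hvI) _ hv).1).2
    rwa [mul_assoc x, idem_mul_self, ← mul_assoc, mul_assoc x, idem_mul_self] at this
  obtain ⟨u, hu, huJ⟩ : ∃ u ∈ W, γ.idem F u ∈ J := by
    obtain ⟨v, hv, w, hw, j, k, x, hx, y, hy, hne⟩ :=
      hγ.exists_idem_mul_ne_zero hW (hJ a haJ) ha
    obtain ⟨p, q, b, hb, rfl, h⟩ := γ.exists_star_mul_mul_real_eq_smul_idem
      (γ.componentHat_mul F (γ.componentHat_mul F hx hai) hy) hne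
    refine ⟨p.tgt, hW.prop.mem_of_isWalk p.isWalk hv, ?_⟩
    rw [← J.smul_mem_iff hb, ← h]
    have h1 : γ.toLHat F (star F p.src p.edges) * γ.idem F p.src * x ∈ γ.idealI F W :=
      mul_mem_idealI_right (mul_mem_idealI_left _ (idem_mem_idealI hv)) _
    have h2 : y * γ.idem F w * γ.toLHat F (real F q.src q.edges) ∈ γ.idealI F W :=
      mul_mem_idealI_right (mul_mem_idealI_left _ (idem_mem_idealI hw)) _
    have := (hmul _ h2 _ (hmul _ h1 _ haJ).1).2
    simpa only [mul_assoc] using this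
  have hidem : ∀ v ∈ W, γ.idem F v ∈ J := fun v hv =>
    hγ.connected_induction hW (P := fun v => γ.idem F v ∈ J) (fun e he => by
      constructor
      · intro h
        rw [← ghost_mul_idem_mul_edge γ F he]
        exact hsand h _ _
      · intro h
        rw [← edge_mul_idem_mul_ghost γ F he]
        exact hsand h _ _) hu hv huJ
  -- `J` is an ideal of `I(W)` only; the following is an ideal of the graded completion
  let K : Submodule F (γ.LHat F) :=
    { carrier := {c | ∀ x y, x * c * y ∈ J}
      zero_mem' := by simp
      add_mem' := fun hb hc x y => by
        rw [mul_add, add_mul]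
        exact add_mem (hb x y) (hc x y)
      smul_mem' := fun c b hb x y => by
        rw [mul_smul_comm, smul_mul_assoc]
        exact J.smul_mem c (hb x y) }
  have hK : IsClosed (K : Set (γ.LHat F)) := by
    simp only [K, Submodule.coe_set_mk, AddSubmonoid.coe_set_mk, AddSubsemigroup.coe_set_mk,
      Set.ofPred_forall]
    exact isClosed_iInter fun x => isClosed_iInter fun y =>
      hcl.preimage ((continuous_const_mul x).mul_const y)
  have hKmul (b : γ.LHat F) : ∀ c ∈ K, b * c ∈ K ∧ c * b ∈ K := by
    refine fun c hc => ⟨fun x y => ?_, fun x y => ?_⟩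
    · rw [← mul_assoc]
      exact hc (x * b) y
    · have := hc x (b * y)
      simpa only [mul_assoc] using this
  intro x hx
  have hxK := mem_idealI_iff.1 hx K ⟨hK, hKmul, fun w hw =>
    γ.vtxHat_mem_of_forall_idem hW' hK hKmul (fun v hv => hsand (hidem v hv)) hw⟩
  have := hxK 1 1
  rwa [one_mul, mul_one] at this

theorem IsRegular.isTopologicallyGradedSimple (hγ : γ.IsRegular) (hW : W ∈ G.frame) :
    IsTopologicallyGradedSimple F (γ.idealIComponent F W) := by
  refine ⟨isInternal_idealIComponent, fun i j a ha b hb => γ.componentHat_mul F ha hb, ?_, ?_⟩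
  · obtain ⟨w, hw⟩ := hW.prop.1
    refine ⟨⟨γ.vtxHat F w, vtxHat_mem_idealI hw⟩, ⟨γ.vtxHat F w, vtxHat_mem_idealI hw⟩, fun h => ?_⟩
    have h1 : γ.vtxHat F w * γ.vtxHat F w = 0 := congrArg Subtype.val h
    rw [← toLHat_vtx, ← map_mul, Leavitt.vtx_mul_self] at h1
    exact γ.vtxHat_ne_zero F w h1
  · intro J hcl hmul hgr
    by_cases h0 : ∀ i, J ⊓ γ.idealIComponent F W i = ⊥
    · left
      rw [← hgr]
      simp [h0]
    right
    push Not at h0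
    obtain ⟨i, hi⟩ := h0
    obtain ⟨a, ⟨haJ, hai⟩, ha⟩ := Submodule.exists_mem_ne_zero_of_ne_bot hi
    let J' : Submodule F (γ.LHat F) :=
      { carrier := Subtype.val '' (J : Set (γ.idealI F W))
        zero_mem' := ⟨0, J.zero_mem, rfl⟩
        add_mem' := by
          rintro _ _ ⟨x, hx, rfl⟩ ⟨y, hy, rfl⟩
          exact ⟨x + y, J.add_mem hx hy, rfl⟩
        smul_mem' := by
          rintro c _ ⟨x, hx, rfl⟩
          exact ⟨c • x, J.smul_mem c hx, rfl⟩ }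
    have hJ' := hγ.idealI_le_of_mem hW (J := J')
      (isClosed_idealI.isClosedEmbedding_subtypeVal.isClosedMap _ hcl)
      (by rintro _ ⟨x, -, rfl⟩; exact x.2)
      (by
        rintro b hb _ ⟨x, hx, rfl⟩
        exact ⟨⟨_, (hmul ⟨b, hb⟩ x hx).1, rfl⟩, ⟨_, (hmul ⟨b, hb⟩ x hx).2, rfl⟩⟩)
      ⟨a, haJ, rfl⟩ hai (fun h => ha (Subtype.ext h))
    rw [eq_top_iff]
    rintro ⟨x, hx⟩ -
    obtain ⟨y, hy, hyx⟩ := hJ' x hx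
    exact (Subtype.ext hyx : y = ⟨x, hx⟩) ▸ hy

end Specialization

end DirGraph

theorem proposition2 {F V E : Type*} [Field F] [Fintype V] [Fintype E] (G : DirGraph V E)
    (γ : G.Specialization) (hγ : γ.IsRegular) (W : Set V) (hW : W ∈ G.frame) :
    IsTopologicallyGradedSimple F (γ.idealIComponent F W) := by
  exact hγ.isTopologicallyGradedSimple hW
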